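/- \textbf{Symbolic heaps.} A symbolic heap is $\varphi=\exists \mathbf z\,.\,\Sigma * \Gamma : \Pi$ with a tuple $\mathbf x_0=(\mathbf x_0[1],\dots,\mathbf x_0[n])$ of pairwise distinct free variables, quantified variables $\mathbf z$, a spatial part $\Sigma$ (a separating conjunction of points-to assertions $x\mapsto(y_1,\dots,y_k)$), predicate calls $\Gamma=P_1\mathbf x_1*\dots*P_m\mathbf x_m$ and a finite set $\Pi$ of equalities and disequalities between variables. The constant $\mathbf{null}$ is treated as the additional parameter $\mathbf x_0[0]$. The variables of $\varphi$ are $\mathbf{null}$, its free and its quantified variables. $\varphi$ is \emph{reduced} if $m=0$. Let $\mathrm{SL}_{\le\alpha}$ (resp. $\mathrm{RSL}_{\le\alpha}$) be the set of all (reduced) symbolic heaps with $n\le\alpha$. If each $\tau_i$ has as many free variables as $\mathbf x_i$ has entries, then $\varphi[P_1/\tau_1,\dots,P_m/\tau_m]$ is obtained by replacing the $i$-th call by the body of $\tau_i$, with its free variables replaced by $\mathbf x_i$ and its quantified variables added (renamed apart) to those of $\varphi$. \textbf{Semantics.} Fix a set of values with an infinite subset of locations and a value for $\mathbf{null}$ that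 is not a location. A heap $h$ is a finite partial map from locations to tuples of values; satisfaction of $\Sigma$ and $\Pi$ by a stack--heap pair $(s,h)$ is the usual (precise) one of separation logic, with $s(\mathbf{null})$ the value for $\mathbf{null}$. For a reduced $\tau=\exists\mathbf z.\Sigma:\Pi$ and variables $x,y$ of $\tau$, we say that $x=y$, $x\neq y$, that $x$ is allocated, and that $x$ points to $y$ (written $x\mapsto_\tau y$) holds \emph{definitely} if $s(x)=s(y)$, $s(x)\ne s(y)$, $s(x)\in\mathrm{dom}(h)$, and $s(x)\in\mathrm{dom}(h)$ with $s(y)$ an entry of $h(s(x))$, respectively, for all $(s,h)$ that satisfy $\Sigma:\Pi$ (where $s$ also interprets $\mathbf z$). The variable $y$ is \emph{definitely reachable} from $x$, written $x\rightsquigarrow_\tau y$, if $(x,y)$ lies in the transitive closure of $\mapsto_\tau$ on the variables of $\tau$. \textbf{Heap automata.} A heap automaton over $\mathrm{SL}_{\le\alpha}$ consists of a finite set $Q$ of states, a set $F\subseteq Q$ of final states, and a decidable relation $\Delta\subseteq Q^*\times \mathrm{SL}_{\le\alpha}\times Q$ such that $(\mathbf q,\varphi,p)\in\Delta$ implies that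 $|\mathbf q|$ is the number of predicate calls of $\varphi$. It is \emph{compositional} if for all $p\in Q$, $\varphi\in\mathrm{SL}_{\le\alpha}$ with $m\ge 0$ predicate calls, and $\tau_1,\dots,\tau_m\in\mathrm{RSL}_{\le\alpha}$ for which the replacement is defined, \[\exists\mathbf q\in Q^m:\ (\mathbf q,\varphi,p)\in\Delta\ \wedge\ \bigwedge_{i=1}^m(\varepsilon,\tau_i,\mathbf q[i])\in\Delta\quad\Longleftrightarrow\quad(\varepsilon,\varphi[P_1/\tau_1,\dots,P_m/\tau_m],p)\in\Delta .\] Its language is $L(\mathfrak A)=\{\tau\in\mathrm{RSL}_{\le\alpha}\mid\exists q\in F:(\varepsilon,\tau,q)\in\Delta\}$. \textbf{Theorem.} Let $\alpha\in\mathbb N$ and let $R\subseteq\{0,\dots,\alpha\}^2$. Then there is a compositional heap automaton $\mathfrak A$ over $\mathrm{SL}_{\le\alpha}$ with \[L(\mathfrak A)=\{\tau\in\mathrm{RSL}_{\le\alpha}\mid\{(i,j)\mid 0\le i,j\le n_\tau,\ \mathbf x_0^\tau[i]\rightsquigarrow_\tau\mathbf x_0^\tau[j]\}=R\},\] where $n_\tau$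 is the number of free variables of $\tau$. Moreover, $\mathfrak A$ can be chosen such that it tracks allocation, equalities, disequalities and reachability between parameters: for each $\tau\in\mathrm{RSL}_{\le\alpha}$ there is a state $q$ with $(\varepsilon,\tau,q)\in\Delta$, and each such $q$ determines the set of all $i\le n_\tau$ for which $\mathbf x_0^\tau[i]$ is definitely allocated, and the sets of all pairs $(i,j)$ with $i,j\le n_\tau$ for which $\mathbf x_0^\tau[i]$ and $\mathbf x_0^\tau[j]$ are definitely equal, are definitely unequal, and satisfy $\mathbf x_0^\tau[i]\rightsquigarrow_\tau\mathbf x_0^\tau[j]$, respectively. -/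

import Mathlib

namespace SymHeap

/-! ### Syntax of symbolic heaps -/

/-- Variables of a symbolic heap: the constant `null`, the free variables `free 0, free 1, …`
(the entries of the tuple of pairwise distinct free variables, addressed by position) and the
existentially quantified variables `bound 0, bound 1, …`. -/
inductive Var : Type
  | null : Var
  | free : ℕ → Var
  | bound : ℕ → Var
  deriving DecidableEq

/-- A points-to assertion `src ↦ (tgt₁, …, tgtₖ)`. -/
structure PointsTo : Type where
  src : Var
  tgt : List Var

/-- A predicate symbol: a name together with its arity. -/
structure PredSymbol : Type where
  name : ℕ
  arity : ℕ

/-- A predicate call `P a₁ … aₙ`. -/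
structure Call : Type where
  pred : PredSymbol
  args : List Var

/-- A pure formula `a = b` or `a ≠ b`. -/
inductive PureFormula : Type
  | eq : Var → Var → PureFormula
  | ne : Var → Var → PureFormula
  deriving DecidableEq

/-- A symbolic heap `∃ z . Σ * Γ : Π` with `numFree` free variables (not counting `null`),
`numBound` quantified variables `z`, spatial part `Σ` (`[]` is `emp`), predicate calls `Γ` and
a finite set `Π` of pure formulas. -/
structure SymbolicHeap : Type where
  numFree : ℕ
  numBound : ℕ
  spatial : List PointsTo
  calls : List Call
  pure : Finset PureFormula

/-- A variable belongs to a symbolic heap with `n` free and `k` quantified variables. -/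
def Var.InScope (n k : ℕ) : Var → Prop
  | .null => True
  | .free i => i < n
  | .bound j => j < k

/-- Both sides of a pure formula belong to the symbolic heap. -/
def PureFormula.InScope (n k : ℕ) : PureFormula → Prop
  | .eq a b => a.InScope n k ∧ b.InScope n k
  | .ne a b => a.InScope n k ∧ b.InScope n k

/-- The set of all variables of a symbolic heap (including `null`). -/
def SymbolicHeap.vars (φ : SymbolicHeap) : Set Var :=
  {x | x.InScope φ.numFree φ.numBound}

/-- Every variable that occurs is `null`, free or quantified, and predicate symbols are applied
to as many arguments as their arity says. -/
structure SymbolicHeap.WellFormed (φ : SymbolicHeap) : Prop where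
  spatial_src : ∀ a ∈ φ.spatial, a.src ∈ φ.vars
  spatial_tgt : ∀ a ∈ φ.spatial, ∀ y ∈ a.tgt, y ∈ φ.vars
  calls_arity : ∀ c ∈ φ.calls, c.args.length = c.pred.arity
  calls_args : ∀ c ∈ φ.calls, ∀ y ∈ c.args, y ∈ φ.vars
  pure_vars : ∀ π ∈ φ.pure, π.InScope φ.numFree φ.numBound

/-- The symbolic heaps with at most `α` free variables. -/
def SL (α : ℕ) : Set SymbolicHeap :=
  {φ | φ.WellFormed ∧ φ.numFree ≤ α}

/-- A symbolic heap is reduced if it contains no predicate calls. -/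
def SymbolicHeap.Reduced (φ : SymbolicHeap) : Prop :=
  φ.calls = []

/-- The reduced symbolic heaps with at most `α` free variables. -/
def RSL (α : ℕ) : Set SymbolicHeap :=
  {τ | τ ∈ SL α ∧ τ.Reduced}

/-- The `i`-th parameter: the `0`-th one is `null`, the others are the free variables in their
order. -/
def param : ℕ → Var
  | 0 => .null
  | i + 1 => .free i

/-! ### Predicate replacement -/

/-- Replace the free variables by the given arguments, and rename the quantified variables to
the fresh ones `bound k, bound (k + 1), …`. -/
def Var.inst (args : List Var) (k : ℕ) : Var → Var
  | .null => .null
  | .free i => args.getD i .null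
  | .bound j => .bound (k + j)

/-- The action of `Var.inst` on points-to assertions. -/
def PointsTo.inst (args : List Var) (k : ℕ) (a : PointsTo) : PointsTo :=
  ⟨a.src.inst args k, a.tgt.map (Var.inst args k)⟩

/-- The action of `Var.inst` on predicate calls. -/
def Call.inst (args : List Var) (k : ℕ) (c : Call) : Call :=
  ⟨c.pred, c.args.map (Var.inst args k)⟩

/-- The action of `Var.inst` on pure formulas. -/
def PureFormula.inst (args : List Var) (k : ℕ) : PureFormula → PureFormula
  | .eq a b => .eq (a.inst args k) (b.inst args k)
  | .ne a b => .ne (a.inst args k) (b.inst args k)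

/-- Add to `φ` the body of `τ`, where the free variables of `τ` are replaced by `args` and its
quantified variables become additional quantified variables. -/
def SymbolicHeap.plug (φ : SymbolicHeap) (args : List Var) (τ : SymbolicHeap) : SymbolicHeap where
  numFree := φ.numFree
  numBound := φ.numBound + τ.numBound
  spatial := φ.spatial ++ τ.spatial.map (PointsTo.inst args φ.numBound)
  calls := φ.calls ++ τ.calls.map (Call.inst args φ.numBound)
  pure := φ.pure ∪ τ.pure.image (PureFormula.inst args φ.numBound)

/-- `φ[P₁ / τ₁, …, Pₘ / τₘ]`: the `i`-th predicate call of `φ` is replaced by `τᵢ`, whose free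
variables are identified with the arguments of that call. -/
def SymbolicHeap.replace (φ : SymbolicHeap) (τs : List SymbolicHeap) : SymbolicHeap :=
  (φ.calls.zip τs).foldl (fun ψ cτ => ψ.plug cτ.1.args cτ.2) { φ with calls := [] }

/-! ### Semantics of reduced symbolic heaps -/

/-- The values, among them infinitely many addressable locations, and a value for `null` that is
not addressable. -/
structure MemoryModel (Val : Type*) where
  Loc : Set Val
  nil : Val
  loc_infinite : Loc.Infinite
  nil_not_loc : nil ∉ Loc

/-- A heap: a finite partial map from locations to tuples of values. -/
structure Heap {Val : Type*} (M : MemoryModel Val) where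
  get : Val → Option (List Val)
  finite_dom : {v | get v ≠ none}.Finite
  dom_loc : {v | get v ≠ none} ⊆ M.Loc

/-- The set of allocated locations. -/
def Heap.dom {Val : Type*} {M : MemoryModel Val} (h : Heap M) : Set Val :=
  {v | h.get v ≠ none}

/-- `h` is the union of the heaps `h₁` and `h₂`, whose domains are disjoint. -/
def Heap.IsDisjointUnion {Val : Type*} {M : MemoryModel Val} (h h₁ h₂ : Heap M) : Prop :=
  Disjoint h₁.dom h₂.dom ∧ ∀ v, h.get v = (h₁.get v).or (h₂.get v)

/-- `s, h ⊨ x ↦ (y₁, …, yₖ)`. -/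
def PointsTo.Sat {Val : Type*} {M : MemoryModel Val} (s : Var → Val) (h : Heap M)
    (a : PointsTo) : Prop :=
  h.dom = {s a.src} ∧ h.get (s a.src) = some (a.tgt.map s)

/-- `s, h ⊨ Σ` for a separating conjunction `Σ` of points-to assertions. -/
def SpatialSat {Val : Type*} {M : MemoryModel Val} (s : Var → Val) :
    Heap M → List PointsTo → Prop
  | h, [] => h.dom = ∅
  | h, a :: rest => ∃ h₁ h₂ : Heap M,
      h.IsDisjointUnion h₁ h₂ ∧ a.Sat s h₁ ∧ SpatialSat s h₂ rest

/-- Truth of a pure formula under a stack. -/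
def PureFormula.Sat {Val : Type*} (s : Var → Val) : PureFormula → Prop
  | .eq a b => s a = s b
  | .ne a b => s a ≠ s b

/-- The stack `s` (which interprets the quantified variables, too) and the heap `h` satisfy the
quantifier-free body of the reduced symbolic heap `τ`. The models of `τ` are the restrictions of
such pairs `(s, h)` to the free variables. -/
def SymbolicHeap.BodySat {Val : Type*} {M : MemoryModel Val} (τ : SymbolicHeap)
    (s : Var → Val) (h : Heap M) : Prop :=
  s .null = M.nil ∧ SpatialSat s h τ.spatial ∧ ∀ π ∈ τ.pure, π.Sat s

/-! ### Definite relationships between the variables of a reduced symbolic heap -/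

/-- `x` and `y` are definitely equal. -/
def DefEq {Val : Type*} (M : MemoryModel Val) (τ : SymbolicHeap) (x y : Var) : Prop :=
  ∀ (s : Var → Val) (h : Heap M), τ.BodySat s h → s x = s y

/-- `x` and `y` are definitely unequal. -/
def DefNe {Val : Type*} (M : MemoryModel Val) (τ : SymbolicHeap) (x y : Var) : Prop :=
  ∀ (s : Var → Val) (h : Heap M), τ.BodySat s h → s x ≠ s y

/-- `x` is definitely allocated. -/
def DefAlloc {Val : Type*} (M : MemoryModel Val) (τ : SymbolicHeap) (x : Var) : Prop :=
  ∀ (s : Var → Val) (h : Heap M), τ.BodySat s h → s x ∈ h.dom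

/-- `x` definitely points to `y`: the location of `x` is allocated and `y` is an entry of the
tuple stored there. -/
def DefPointsTo {Val : Type*} (M : MemoryModel Val) (τ : SymbolicHeap) (x y : Var) : Prop :=
  ∀ (s : Var → Val) (h : Heap M), τ.BodySat s h → ∃ t, h.get (s x) = some t ∧ s y ∈ t

/-- `y` is definitely reachable from `x`: the transitive closure of the definite points-to
relation on the variables of `τ`. -/
def DefReach {Val : Type*} (M : MemoryModel Val) (τ : SymbolicHeap) : Var → Var → Prop :=
  Relation.TransGen fun x y => x ∈ τ.vars ∧ y ∈ τ.vars ∧ DefPointsTo M τ x y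

/-- The parameters of `τ`, by position, that are definitely allocated. -/
def allocSet {Val : Type*} (M : MemoryModel Val) (α : ℕ) (τ : SymbolicHeap) :
    Set (Fin (α + 1)) :=
  {i | (i : ℕ) ≤ τ.numFree ∧ DefAlloc M τ (param i)}

/-- The restriction of a relation between variables to the parameters of `τ`, by position. -/
def paramRel (α : ℕ) (τ : SymbolicHeap) (r : Var → Var → Prop) :
    Set (Fin (α + 1) × Fin (α + 1)) :=
  {p | (p.1 : ℕ) ≤ τ.numFree ∧ (p.2 : ℕ) ≤ τ.numFree ∧ r (param p.1) (param p.2)}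

/-- The reduced symbolic heaps with at most `α` free variables whose definite reachability
relation between parameters is `R`. -/
def ReachProperty {Val : Type*} (M : MemoryModel Val) (α : ℕ)
    (R : Set (Fin (α + 1) × Fin (α + 1))) : Set SymbolicHeap :=
  {τ | τ ∈ RSL α ∧ paramRel α τ (DefReach M τ) = R}

/-! ### Finite descriptions of symbolic heaps, for decidability -/

/-- Variables as coded data. -/
def Var.equiv : Var ≃ Option (ℕ ⊕ ℕ) where
  toFun
    | .null => none
    | .free i => some (.inl i)
    | .bound j => some (.inr j)
  invFun
    | none => .null
    | some (.inl i) => .free i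
    | some (.inr j) => .bound j
  left_inv x := by cases x <;> rfl
  right_inv x := by rcases x with _ | (_ | _) <;> rfl

instance : Primcodable Var := Primcodable.ofEquiv _ Var.equiv

/-- Points-to assertions as coded data. -/
def PointsTo.equiv : PointsTo ≃ Var × List Var where
  toFun a := (a.src, a.tgt)
  invFun a := ⟨a.1, a.2⟩
  left_inv _ := rfl
  right_inv _ := rfl

instance : Primcodable PointsTo := Primcodable.ofEquiv _ PointsTo.equiv

/-- Predicate calls as coded data. -/
def Call.equiv : Call ≃ (ℕ × ℕ) × List Var where
  toFun c := ((c.pred.name, c.pred.arity), c.args)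
  invFun c := ⟨⟨c.1.1, c.1.2⟩, c.2⟩
  left_inv _ := rfl
  right_inv _ := rfl

instance : Primcodable Call := Primcodable.ofEquiv _ Call.equiv

/-- Pure formulas as coded data. -/
def PureFormula.equiv : PureFormula ≃ (Var × Var) ⊕ (Var × Var) where
  toFun
    | .eq a b => .inl (a, b)
    | .ne a b => .inr (a, b)
  invFun
    | .inl (a, b) => .eq a b
    | .inr (a, b) => .ne a b
  left_inv x := by cases x <;> rfl
  right_inv x := by rcases x with _ | _ <;> rfl

instance : Primcodable PureFormula := Primcodable.ofEquiv _ PureFormula.equiv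

/-- A written symbolic heap, where the finite set of pure formulas is given by a list. -/
abbrev RawHeap : Type :=
  ℕ × ℕ × List PointsTo × List Call × List PureFormula

/-- The symbolic heap that is described by a written one. Each symbolic heap has such a
description. -/
def SymbolicHeap.ofRaw (r : RawHeap) : SymbolicHeap where
  numFree := r.1
  numBound := r.2.1
  spatial := r.2.2.1
  calls := r.2.2.2.1
  pure := r.2.2.2.2.toFinset

/-! ### Heap automata -/

/-- A heap automaton over a set `C` of symbolic heaps: a finite set of states, a decidable
transition relation `Δ ⊆ Q* × C × Q` in which the number of input states is the number of
predicate calls, and a set `F` of final states. -/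
structure HeapAutomaton (C : Set SymbolicHeap) where
  numStates : ℕ
  Δ : List (Fin numStates) → SymbolicHeap → Fin numStates → Prop
  F : Set (Fin numStates)
  mem_of_trans : ∀ q φ p, Δ q φ p → φ ∈ C
  length_of_trans : ∀ q φ p, Δ q φ p → q.length = φ.calls.length
  decidable_trans : ComputablePred
    fun x : List (Fin numStates) × RawHeap × Fin numStates =>
      Δ x.1 (SymbolicHeap.ofRaw x.2.1) x.2.2

/-- The compositionality property. The `i`-th heap `τᵢ` has as many free variables as the `i`-th
predicate call has arguments, so that the replacement is defined. -/
def HeapAutomaton.Compositional {C : Set SymbolicHeap} (A : HeapAutomaton C) : Prop :=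
  ∀ (p : Fin A.numStates) (φ : SymbolicHeap) (τs : List SymbolicHeap), φ ∈ C →
    (∀ τ ∈ τs, τ ∈ C ∧ τ.Reduced) →
    List.Forall₂ (fun c τ => τ.numFree = c.args.length) φ.calls τs →
    ((∃ q : List (Fin A.numStates), A.Δ q φ p ∧ List.Forall₂ (fun τ qi => A.Δ [] τ qi) τs q) ↔
      A.Δ [] (φ.replace τs) p)

/-- The language: the reduced symbolic heaps in `C` that are assigned a final state. -/
def HeapAutomaton.language {C : Set SymbolicHeap} (A : HeapAutomaton C) : Set SymbolicHeap :=
  {τ | τ ∈ C ∧ τ.Reduced ∧ ∃ q ∈ A.F, A.Δ [] τ q}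

end SymHeap

/-!
The state of a reduced symbolic heap `τ` consists of the four relationships between its parameters
that are to be tracked. There are finitely many states, so two things have to be shown: the state
of `φ[P₁ / τ₁, …, Pₘ / τₘ]` depends only on `φ` and on the states of the `τᵢ`, and the state of a
reduced symbolic heap can be computed. Then one representative is chosen for each state, and the
transition relation evaluates `φ` with its calls replaced by the representatives of the given
states (`stateAutomaton`).

*Syntactic description.* The body of `τ` is turned into a `ConstraintSystem` of equalities,
disequalities, allocated variables and points-to edges. If the equivalence relation generated by
the equalities identifies no two variables that have to be different, there is a model in which
exactly the variables that have to be equal are equal, because there are infinitely many locations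
(`exists_bodySat_iff`). Hence each definite relationship holds if and only if it follows from the
constraints or the constraints are inconsistent (`defEq_iff`, `defNe_iff`, `defAlloc_iff`,
`defReach_iff`).

*Congruence.* The constraints of a heap with another heap plugged in are obtained by gluing the two
systems (`constraints_plug`). The components overlap only in visible variables, so a chain of
equalities between variables of two components either stays inside of one component or can be cut
at visible variables (`ConstraintSystem.Equal.link`), and the same holds for paths of points-to
edges (`ConstraintSystem.Step.of_glue`). Therefore a component may be exchanged for one with the
same relationships between its visible variables (`ConstraintSystem.EntailedOn.glue`). By iteration
over the calls of `φ`, this yields `stateOf_replace_congr`.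

*Decidability.* All relationships are expressed by reachability in finite graphs that are read off
from the written heap, and reachability is primitive recursive since the transitive closure of a
finite relation can be computed by recursion on its list of edges (`primrecPred_reflTransGen`).
-/

namespace SymHeap

/-! ### Constraint systems and gluing -/

/-- The constraints that the body of a reduced symbolic heap imposes on its variables: generating
relations for equalities, disequalities, allocation and points-to edges. Closure under equality is
not built in; it is part of the derived relations `Equal`, `Unequal`, `Alloc`, `Step`, `Reach`. -/
@[ext]
structure ConstraintSystem (V : Type*) where
  eq : V → V → Prop
  ne : V → V → Prop
  al : V → Prop
  pt : V → V → Prop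

namespace ConstraintSystem

open Relation

section Basic

variable {V : Type*} (S : ConstraintSystem V) {x y z : V}

/-- The equivalence relation generated by `S.eq`. -/
def Equal : V → V → Prop :=
  ReflTransGen fun a b => S.eq a b ∨ S.eq b a

/-- The disequalities that follow from `S`. -/
def Unequal (x y : V) : Prop :=
  ∃ u v, (S.ne u v ∨ S.ne v u) ∧ S.Equal x u ∧ S.Equal y v

/-- The variables that are equal to an allocated one. -/
def Alloc (x : V) : Prop :=
  ∃ u, S.al u ∧ S.Equal x u

/-- The points-to edges that follow from `S`. -/
def Step (x y : V) : Prop :=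
  ∃ u v, S.pt u v ∧ S.Equal x u ∧ S.Equal y v

/-- Reachability along at least one points-to edge. -/
def Reach : V → V → Prop :=
  TransGen S.Step

/-- Reachability along any number of points-to edges. -/
def Leads (x y : V) : Prop :=
  S.Equal x y ∨ S.Reach x y

/-- Two variables are required to be equal and unequal at the same time. -/
def Inconsistent : Prop :=
  ∃ u v, S.ne u v ∧ S.Equal u v

/-- All variables that occur in `S` belong to `D`. -/
structure SupportedOn (D : Set V) : Prop where
  eq : ∀ {u v}, S.eq u v → u ∈ D ∧ v ∈ D
  ne : ∀ {u v}, S.ne u v → u ∈ D ∧ v ∈ D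
  al : ∀ {u}, S.al u → u ∈ D
  pt : ∀ {u v}, S.pt u v → u ∈ D ∧ v ∈ D

/-- Unless `S'` is inconsistent, so that it entails everything, each relationship between variables
of `W` that holds in `S` holds in `S'`. -/
def EntailedOn (W : Set V) (S S' : ConstraintSystem V) : Prop :=
  ¬ S'.Inconsistent → ¬ S.Inconsistent ∧
    (∀ x ∈ W, ∀ y ∈ W, S.Equal x y → S'.Equal x y) ∧
    (∀ x ∈ W, ∀ y ∈ W, S.Unequal x y → S'.Unequal x y) ∧
    (∀ x ∈ W, S.Alloc x → S'.Alloc x) ∧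
    (∀ x ∈ W, ∀ y ∈ W, S.Reach x y → S'.Reach x y)

variable {S}

theorem EntailedOn.refl (W : Set V) (S : ConstraintSystem V) : EntailedOn W S S :=
  fun h => ⟨h, fun _ _ _ _ h => h, fun _ _ _ _ h => h, fun _ _ h => h, fun _ _ _ _ h => h⟩

theorem EntailedOn.mono {W W' : Set V} {S' : ConstraintSystem V} (hW : W ⊆ W')
    (h : EntailedOn W' S S') : EntailedOn W S S' := fun hS => by
  obtain ⟨h1, h2, h3, h4, h5⟩ := h hS
  exact ⟨h1, fun x hx y hy => h2 x (hW hx) y (hW hy), fun x hx y hy => h3 x (hW hx) y (hW hy),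
    fun x hx => h4 x (hW hx), fun x hx y hy => h5 x (hW hx) y (hW hy)⟩

theorem Equal.refl (x : V) : S.Equal x x := ReflTransGen.refl

theorem Equal.symm (h : S.Equal x y) : S.Equal y x := by
  induction h with
  | refl => exact .refl _
  | tail _ h ih => exact ReflTransGen.head h.symm ih

theorem Equal.trans (h : S.Equal x y) (h' : S.Equal y z) : S.Equal x z :=
  ReflTransGen.trans h h'

theorem Equal.of_eq (h : S.eq x y) : S.Equal x y := ReflTransGen.single (Or.inl h)

theorem Equal.mem_iff {D : Set V} (hS : S.SupportedOn D) (h : S.Equal x y) : x ∈ D ↔ y ∈ D := by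
  induction h with
  | refl => rfl
  | tail _ h ih =>
    rw [ih]
    rcases h with h | h <;> have := hS.eq h <;> tauto

theorem Unequal.symm (h : S.Unequal x y) : S.Unequal y x := by
  obtain ⟨u, v, h, hx, hy⟩ := h
  exact ⟨v, u, h.symm, hy, hx⟩

theorem Unequal.congr_left (h : S.Unequal y z) (hxy : S.Equal x y) : S.Unequal x z := by
  obtain ⟨u, v, h, hx, hy⟩ := h
  exact ⟨u, v, h, hxy.trans hx, hy⟩

theorem Unequal.congr_right (h : S.Unequal x y) (hzy : S.Equal z y) : S.Unequal x z :=
  (h.symm.congr_left hzy).symm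

theorem Unequal.inconsistent (h : S.Unequal x y) (hxy : S.Equal x y) : S.Inconsistent := by
  obtain ⟨u, v, h | h, hx, hy⟩ := h
  · exact ⟨u, v, h, (hx.symm.trans hxy).trans hy⟩
  · exact ⟨v, u, h, ((hx.symm.trans hxy).trans hy).symm⟩

theorem Unequal.of_ne (h : S.ne x y) : S.Unequal x y :=
  ⟨x, y, Or.inl h, .refl x, .refl y⟩

theorem Alloc.congr (h : S.Alloc y) (hxy : S.Equal x y) : S.Alloc x := by
  obtain ⟨u, hu, hy⟩ := h
  exact ⟨u, hu, hxy.trans hy⟩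

theorem Step.congr_left (h : S.Step y z) (hxy : S.Equal x y) : S.Step x z := by
  obtain ⟨u, v, h, hx, hy⟩ := h
  exact ⟨u, v, h, hxy.trans hx, hy⟩

theorem Step.congr_right (h : S.Step x y) (hyz : S.Equal y z) : S.Step x z := by
  obtain ⟨u, v, h, hx, hy⟩ := h
  exact ⟨u, v, h, hx, hyz.symm.trans hy⟩

theorem Step.mem {D : Set V} (hS : S.SupportedOn D) (h : S.Step x y) : x ∈ D ∧ y ∈ D := by
  obtain ⟨u, v, h, hx, hy⟩ := h
  exact ⟨(hx.mem_iff hS).2 (hS.pt h).1, (hy.mem_iff hS).2 (hS.pt h).2⟩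

theorem Reach.congr_left (h : S.Reach y z) (hxy : S.Equal x y) : S.Reach x z := by
  induction h with
  | single h => exact .single (h.congr_left hxy)
  | tail _ h ih => exact ih.tail h

theorem Reach.congr_right (h : S.Reach x y) (hyz : S.Equal y z) : S.Reach x z := by
  cases h with
  | single h => exact .single (h.congr_right hyz)
  | tail h' h => exact h'.tail (h.congr_right hyz)

theorem Leads.trans (h : S.Leads x y) (h' : S.Leads y z) : S.Leads x z := by
  rcases h with h | h <;> rcases h' with h' | h'
  · exact .inl (h.trans h')
  · exact .inr (h'.congr_left h)
  · exact .inr (h.congr_right h')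
  · exact .inr (TransGen.trans h h')

theorem Leads.reach (h : S.Leads x y) (h' : S.Reach y z) : S.Reach x z := by
  rcases h with h | h
  · exact h'.congr_left h
  · exact TransGen.trans h h'

end Basic

section Glue

variable {V ι : Type*}

/-- The union of the images of the systems `S i` under the maps `f i`. As the heaps that are
described by different components are disjoint, allocated variables of different components are
unequal. -/
def glue (f : ι → V → V) (S : ι → ConstraintSystem V) : ConstraintSystem V where
  eq x y := ∃ i u v, (S i).eq u v ∧ f i u = x ∧ f i v = y
  ne x y := (∃ i u v, (S i).ne u v ∧ f i u = x ∧ f i v = y) ∨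
    ∃ i j u v, i ≠ j ∧ (S i).al u ∧ (S j).al v ∧ f i u = x ∧ f j v = y
  al x := ∃ i u, (S i).al u ∧ f i u = x
  pt x y := ∃ i u v, (S i).pt u v ∧ f i u = x ∧ f i v = y

section Embed

variable {f : ι → V → V} {S : ι → ConstraintSystem V} {i j : ι} {u v : V}

theorem Equal.glue (h : (S i).Equal u v) : (glue f S).Equal (f i u) (f i v) :=
  ReflTransGen.lift (f i) (fun a b h => h.imp (fun h => ⟨i, a, b, h, rfl, rfl⟩)
    (fun h => ⟨i, b, a, h, rfl, rfl⟩)) _ _ h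

theorem Unequal.glue (h : (S i).Unequal u v) : (glue f S).Unequal (f i u) (f i v) := by
  obtain ⟨a, b, h, hu, hv⟩ := h
  exact ⟨f i a, f i b, h.imp (fun h => .inl ⟨i, a, b, h, rfl, rfl⟩)
    (fun h => .inl ⟨i, b, a, h, rfl, rfl⟩), hu.glue, hv.glue⟩

theorem Alloc.glue (h : (S i).Alloc u) : (glue f S).Alloc (f i u) := by
  obtain ⟨a, h, hu⟩ := h
  exact ⟨f i a, ⟨i, a, h, rfl⟩, hu.glue⟩

theorem Reach.glue (h : (S i).Reach u v) : (glue f S).Reach (f i u) (f i v) :=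
  TransGen.lift (f i) (fun _ _ ⟨a, b, h, hu, hv⟩ =>
    ⟨f i a, f i b, ⟨i, a, b, h, rfl, rfl⟩, hu.glue, hv.glue⟩) _ _ h

theorem Inconsistent.glue (h : (S i).Inconsistent) : (glue f S).Inconsistent := by
  obtain ⟨a, b, h, hab⟩ := h
  exact ⟨f i a, f i b, .inl ⟨i, a, b, h, rfl, rfl⟩, hab.glue⟩

theorem Alloc.unequal_glue (hij : i ≠ j) (hu : (S i).Alloc u) (hv : (S j).Alloc v) :
    (ConstraintSystem.glue f S).Unequal (f i u) (f j v) := by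
  obtain ⟨a, ha, hu⟩ := hu
  obtain ⟨b, hb, hv⟩ := hv
  exact ⟨f i a, f j b, .inl (.inr ⟨i, j, a, b, hij, ha, hb, rfl, rfl⟩), hu.glue, hv.glue⟩

end Embed

/-- The component systems `S i` live on `D i`, and their images under `f i` overlap only in the
visible variables `W i ⊆ D i`. -/
structure Interface (f : ι → V → V) (S : ι → ConstraintSystem V) (D W : ι → Set V) : Prop where
  supported : ∀ i, (S i).SupportedOn (D i)
  subset : ∀ i, W i ⊆ D i
  overlap : ∀ {i j u v}, u ∈ D i → v ∈ D j → f i u = f j v →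
    (i = j ∧ u = v) ∨ (u ∈ W i ∧ v ∈ W j)

/-- How an equality between the variable `u` of component `i` and the variable `v` of component
`j` can come about in a glued system: either it holds inside of one component, or it factors
through visible variables, whose equality is taken from the system `T`. -/
def Link (f : ι → V → V) (S : ι → ConstraintSystem V) (W : ι → Set V) (T : ConstraintSystem V)
    (i : ι) (u : V) (j : ι) (v : V) : Prop :=
  (i = j ∧ (S i).Equal u v) ∨
    ∃ b ∈ W i, ∃ b' ∈ W j, (S i).Equal u b ∧ T.Equal (f i b) (f j b') ∧ (S j).Equal b' v

variable {f f' : ι → V → V} {S S' : ι → ConstraintSystem V} {D W : ι → Set V}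

theorem Link.extend {T : ConstraintSystem V} {i j : ι} {u v w : V} (h : Link f S W T i u j v)
    (hvw : (S j).Equal v w) : Link f S W T i u j w := by
  rcases h with ⟨rfl, h⟩ | ⟨b, hb, b', hb', h1, h2, h3⟩
  · exact .inl ⟨rfl, h.trans hvw⟩
  · exact .inr ⟨b, hb, b', hb', h1, h2, h3.trans hvw⟩

section Simulation

variable (hI : Interface f S D W) (hf : ∀ i, ∀ v ∈ W i, f i v = f' i v)
  (hE : ∀ i, ∀ x ∈ W i, ∀ y ∈ W i, (S i).Equal x y → (S' i).Equal x y)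

include hI hf hE

theorem Link.transfer {i j k : ι} {u v w : V} (h : Link f' S W (glue f' S') i u j v)
    (hv : v ∈ D j) (hw : w ∈ D k) (hvw : f j v = f k w) :
    Link f' S W (glue f' S') i u k w := by
  rcases hI.overlap hv hw hvw with ⟨rfl, rfl⟩ | ⟨hv', hw'⟩
  · exact h
  have hvw' : f' j v = f' k w := by rw [← hf j v hv', ← hf k w hw', hvw]
  rcases h with ⟨rfl, h⟩ | ⟨b, hb, b', hb', h1, h2, h3⟩
  · exact .inr ⟨v, hv', w, hw', h, hvw' ▸ .refl _, .refl _⟩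
  · exact .inr ⟨b, hb, w, hw', h1, h2.trans (hvw' ▸ (hE j b' hb' v hv' h3).glue), .refl _⟩

theorem Equal.link {i j : ι} {u v : V} (hu : u ∈ D i) (hv : v ∈ D j)
    (h : (ConstraintSystem.glue f S).Equal (f i u) (f j v)) :
    Link f' S W (ConstraintSystem.glue f' S') i u j v := by
  -- The induction needs the claim for every way of writing the end point as `f j v`.
  suffices H : ∀ z, (ConstraintSystem.glue f S).Equal (f i u) z → ∀ j v, v ∈ D j → z = f j v →
      Link f' S W (ConstraintSystem.glue f' S') i u j v from H _ h j v hv rfl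
  intro z hz
  induction hz with
  | refl =>
    intro j v hv h
    exact Link.transfer hI hf hE (.inl ⟨rfl, .refl u⟩) hu hv h
  | tail _ h ih =>
    intro j v hv hz
    rcases h with ⟨k, a, b, h, rfl, rfl⟩ | ⟨k, b, a, h, rfl, rfl⟩
    · have hab := (hI.supported k).eq h
      exact Link.transfer hI hf hE ((ih k a hab.1 rfl).extend (.of_eq h)) hab.2 hv hz
    · have hab := (hI.supported k).eq h
      exact Link.transfer hI hf hE ((ih k a hab.2 rfl).extend (Equal.of_eq h).symm) hab.1 hv hz

theorem Equal.link_of_visible {i j : ι} {u v : V} (hu : u ∈ W i) (hv : v ∈ D j)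
    (h : (ConstraintSystem.glue f S).Equal (f i u) (f j v)) :
    ∃ b ∈ W j, (ConstraintSystem.glue f' S').Equal (f' i u) (f' j b) ∧ (S j).Equal b v := by
  rcases Equal.link hI hf hE (hI.subset i hu) hv h with ⟨rfl, h'⟩ | ⟨b, hb, b', hb', h1, h2, h3⟩
  · exact ⟨u, hu, .refl _, h'⟩
  · exact ⟨b', hb', (hE i u hu b hb h1).glue.trans h2, h3⟩

theorem Equal.of_glue {i j : ι} {u v : V} (hu : u ∈ W i) (hv : v ∈ W j)
    (h : (ConstraintSystem.glue f S).Equal (f i u) (f j v)) :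
    (ConstraintSystem.glue f' S').Equal (f' i u) (f' j v) := by
  obtain ⟨b, hb, h1, h2⟩ := Equal.link_of_visible hI hf hE hu (hI.subset j hv) h
  exact h1.trans (hE j b hb v hv h2).glue

/-- One edge of a path in the glued system. The path so far is recorded as a path to a visible
variable `a` of some component, followed by a path from `a` inside of this component. -/
theorem Step.of_glue
    (hR : ∀ i, ∀ x ∈ W i, ∀ y ∈ W i, (S i).Reach x y → (S' i).Reach x y)
    {k : ι} {a d z w w' : V} (ha : a ∈ W k) (hd : d ∈ D k)
    (hz : (ConstraintSystem.glue f' S').Leads z (f' k a)) (had : (S k).Leads a d)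
    (hdw : (ConstraintSystem.glue f S).Equal (f k d) w)
    (hw : (ConstraintSystem.glue f S).Step w w') :
    ∃ l, ∃ a' ∈ W l, ∃ d' ∈ D l, (ConstraintSystem.glue f' S').Leads z (f' l a') ∧
      (S l).Reach a' d' ∧ (ConstraintSystem.glue f S).Equal (f l d') w' := by
  obtain ⟨_, _, ⟨l, p, q, hpq, rfl, rfl⟩, h1, h2⟩ := hw
  obtain ⟨hp, hq⟩ := (hI.supported l).pt hpq
  have hstep : (S l).Reach p q := .single ⟨p, q, hpq, .refl p, .refl q⟩
  rcases Equal.link hI hf hE hd hp (hdw.trans h1) with ⟨rfl, h⟩ | ⟨c, hc, c', hc', h3, h4, h5⟩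
  · exact ⟨k, a, ha, q, hq, hz, had.reach (hstep.congr_left h), h2.symm⟩
  · refine ⟨l, c', hc', q, hq, hz.trans (Leads.trans ?_ (.inl h4)), hstep.congr_left h5, h2.symm⟩
    rcases had.trans (.inl h3) with h | h
    · exact .inl (hE k a ha c hc h).glue
    · exact .inr (hR k a ha c hc h).glue

theorem Reach.of_glue
    (hR : ∀ i, ∀ x ∈ W i, ∀ y ∈ W i, (S i).Reach x y → (S' i).Reach x y)
    {i j : ι} {u v : V} (hu : u ∈ W i) (hv : v ∈ W j)
    (h : (ConstraintSystem.glue f S).Reach (f i u) (f j v)) :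
    (ConstraintSystem.glue f' S').Reach (f' i u) (f' j v) := by
  have H : ∀ w, (ConstraintSystem.glue f S).Reach (f i u) w →
      ∃ l, ∃ a ∈ W l, ∃ d ∈ D l, (ConstraintSystem.glue f' S').Leads (f' i u) (f' l a) ∧
        (S l).Reach a d ∧ (ConstraintSystem.glue f S).Equal (f l d) w := by
    intro w hw
    induction hw with
    | single h =>
      exact Step.of_glue hI hf hE hR hu (hI.subset i hu) (.inl (.refl _)) (.inl (.refl _))
        (.refl _) h
    | tail _ h ih =>
      obtain ⟨l, a, ha, d, hd, h1, h2, h3⟩ := ih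
      exact Step.of_glue hI hf hE hR ha hd h1 (.inr h2) h3 h
  obtain ⟨l, a, ha, d, hd, h1, h2, h3⟩ := H _ h
  obtain ⟨b, hb, h4, h5⟩ := Equal.link_of_visible hI hf hE hv hd h3.symm
  exact h1.reach ((hR l a ha b hb (h2.congr_right h5.symm)).glue.congr_right h4.symm)

end Simulation

/-- Gluing is monotone: what a glued system says about visible variables depends only on what its
components say about their visible variables. -/
theorem EntailedOn.glue (hI : Interface f S D W) (hf : ∀ i, ∀ v ∈ W i, f i v = f' i v)
    (hS : ∀ i, EntailedOn (W i) (S i) (S' i)) :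
    EntailedOn {z | ∃ i, ∃ v ∈ W i, f i v = z} (glue f S) (glue f' S') := by
  intro hcons
  have hS' i := hS i (fun h => hcons h.glue)
  have hC i := (hS' i).1
  have hE i := (hS' i).2.1
  have hN i := (hS' i).2.2.1
  have hA i := (hS' i).2.2.2.1
  have hR i := (hS' i).2.2.2.2
  refine ⟨?_, ?_, ?_, ?_, ?_⟩
  · rintro ⟨_, _, ⟨i, u, v, h, rfl, rfl⟩ | ⟨i, j, u, v, hij, hu, hv, rfl, rfl⟩, huv⟩
    · obtain ⟨hu, hv⟩ := (hI.supported i).ne h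
      rcases Equal.link hI hf hE hu hv huv with ⟨-, huv⟩ | ⟨b, hb, b', hb', h1, h2, h3⟩
      · exact hC i ⟨u, v, h, huv⟩
      · exact hcons (Unequal.inconsistent (hN i b hb b' hb'
          (((Unequal.of_ne h).congr_left h1.symm).congr_right h3)).glue h2)
    · rcases Equal.link hI hf hE ((hI.supported i).al hu) ((hI.supported j).al hv) huv with
        ⟨rfl, -⟩ | ⟨b, hb, b', hb', h1, h2, h3⟩
      · exact hij rfl
      · exact hcons (Unequal.inconsistent (Alloc.unequal_glue hij
          (hA i b hb ⟨u, hu, h1.symm⟩) (hA j b' hb' ⟨v, hv, h3⟩)) h2)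
  · rintro _ ⟨i, x, hx, rfl⟩ _ ⟨j, y, hy, rfl⟩ h
    rw [hf i x hx, hf j y hy]
    exact h.of_glue hI hf hE hx hy
  · rintro _ ⟨i, x, hx, rfl⟩ _ ⟨j, y, hy, rfl⟩ ⟨p, q, h, hp, hq⟩
    rw [hf i x hx, hf j y hy]
    -- Up to symmetry, the constraint that separates `p` and `q` is oriented from `p` to `q`.
    have key : ∀ {i j x y p q}, x ∈ W i → y ∈ W j → (ConstraintSystem.glue f S).ne p q →
        (ConstraintSystem.glue f S).Equal (f i x) p → (ConstraintSystem.glue f S).Equal (f j y) q →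
        (ConstraintSystem.glue f' S').Unequal (f' i x) (f' j y) := by
      rintro i j x y _ _ hx hy
        (⟨k, u, v, h, rfl, rfl⟩ | ⟨k, l, u, v, hkl, hu, hv, rfl, rfl⟩) h1 h2
      · obtain ⟨hu, hv⟩ := (hI.supported k).ne h
        obtain ⟨b, hb, h3, h4⟩ := h1.link_of_visible hI hf hE hx hu
        obtain ⟨c, hc, h5, h6⟩ := h2.link_of_visible hI hf hE hy hv
        exact (hN k b hb c hc ⟨u, v, .inl h, h4, h6⟩).glue.congr_left h3 |>.congr_right h5
      · obtain ⟨b, hb, h3, h4⟩ := h1.link_of_visible hI hf hE hx ((hI.supported k).al hu)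
        obtain ⟨c, hc, h5, h6⟩ := h2.link_of_visible hI hf hE hy ((hI.supported l).al hv)
        exact (Alloc.unequal_glue hkl (hA k b hb ⟨u, hu, h4⟩)
          (hA l c hc ⟨v, hv, h6⟩)).congr_left h3 |>.congr_right h5
    rcases h with h | h
    · exact key hx hy h hp hq
    · exact (key hy hx h hq hp).symm
  · rintro _ ⟨i, x, hx, rfl⟩ ⟨_, ⟨k, u, hu, rfl⟩, h⟩
    rw [hf i x hx]
    obtain ⟨b, hb, h1, h2⟩ := h.link_of_visible hI hf hE hx ((hI.supported k).al hu)
    exact (hA k b hb ⟨u, hu, h2⟩).glue.congr h1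
  · rintro _ ⟨i, x, hx, rfl⟩ _ ⟨j, y, hy, rfl⟩ h
    rw [hf i x hx, hf j y hy]
    exact h.of_glue hI hf hE hR hx hy

end Glue

end ConstraintSystem

open Relation
open scoped List

/-! ### The models of a reduced symbolic heap -/

section Semantics

variable {Val : Type*} {M : MemoryModel Val}

/-- A separating conjunction of points-to assertions determines its heap, and its sources are
pairwise distinct locations. -/
theorem SpatialSat.spec {s : Var → Val} {L : List PointsTo} {h : Heap M}
    (hL : SpatialSat s h L) :
    (L.map fun p => s p.src).Nodup ∧ (∀ p ∈ L, s p.src ∈ M.Loc) ∧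
      ∀ v t, h.get v = some t ↔ ∃ p ∈ L, s p.src = v ∧ p.tgt.map s = t := by
  induction L generalizing h with
  | nil =>
    refine ⟨by simp, by simp, fun v t => ?_⟩
    have : v ∉ h.dom := by rw [show h.dom = ∅ from hL]; simp
    simp only [Heap.dom, ne_eq, Set.mem_ofPred_eq, not_not] at this
    simp [this]
  | cons a L ih =>
    obtain ⟨h₁, h₂, ⟨hdisj, hget⟩, ⟨hdom, ha⟩, hL⟩ := hL
    obtain ⟨ih1, ih2, ih3⟩ := ih hL
    have hdom₂ : ∀ p ∈ L, s p.src ∈ h₂.dom := fun p hp => by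
      simp [Heap.dom, (ih3 _ _).2 ⟨p, hp, rfl, rfl⟩]
    have ha₂ : s a.src ∉ h₂.dom := fun hmem =>
      Set.disjoint_left.1 hdisj (by rw [hdom]; rfl) hmem
    refine ⟨?_, ?_, fun v t => ?_⟩
    · rw [List.map_cons, List.nodup_cons]
      refine ⟨fun hmem => ?_, ih1⟩
      obtain ⟨p, hp, hps⟩ := List.mem_map.1 hmem
      exact ha₂ (hps ▸ hdom₂ p hp)
    · rintro p hp
      rcases List.mem_cons.1 hp with rfl | hp
      · exact h₁.dom_loc (show s p.src ∈ h₁.dom by rw [hdom]; rfl)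
      · exact ih2 p hp
    · rw [hget]
      by_cases hv : v = s a.src
      · subst hv
        rw [ha]
        simp only [Option.some_or, Option.some.injEq, List.mem_cons, exists_eq_or_imp, true_and]
        refine ⟨.inl, ?_⟩
        rintro (h | ⟨p, hp, hps, -⟩)
        · exact h
        · exact absurd (hps ▸ hdom₂ p hp) ha₂
      · have : v ∉ h₁.dom := by rw [hdom]; exact hv
        simp only [Heap.dom, ne_eq, Set.mem_ofPred_eq, not_not] at this
        simp [this, ih3, Ne.symm hv]

theorem SpatialSat.mem_dom {s : Var → Val} {L : List PointsTo} {h : Heap M}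
    (hL : SpatialSat s h L) (v : Val) : v ∈ h.dom ↔ ∃ p ∈ L, s p.src = v := by
  simp only [Heap.dom, ne_eq, Set.mem_ofPred_eq, Option.ne_none_iff_exists']
  constructor
  · rintro ⟨t, ht⟩
    obtain ⟨p, hp, h, -⟩ := (hL.spec.2.2 _ _).1 ht
    exact ⟨p, hp, h⟩
  · rintro ⟨p, hp, h⟩
    exact ⟨_, (hL.spec.2.2 _ _).2 ⟨p, hp, h, rfl⟩⟩

theorem exists_spatialSat {s : Var → Val} {L : List PointsTo}
    (hnd : (L.map fun p => s p.src).Nodup) (hloc : ∀ p ∈ L, s p.src ∈ M.Loc) :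
    ∃ h : Heap M, SpatialSat s h L := by
  classical
  induction L with
  | nil => exact ⟨⟨fun _ => none, by simp, by simp⟩, by simp [SpatialSat, Heap.dom]⟩
  | cons a L ih =>
    rw [List.map_cons, List.nodup_cons] at hnd
    obtain ⟨h₂, hL⟩ := ih hnd.2 fun p hp => hloc p (List.mem_cons_of_mem _ hp)
    have hdom : {v | (if v = s a.src then some (a.tgt.map s) else none) ≠ none} = {s a.src} := by
      ext v; simp
    let h₁ : Heap M := ⟨fun v => if v = s a.src then some (a.tgt.map s) else none,
      hdom ▸ Set.finite_singleton _, by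
        rw [hdom]; simpa using hloc a List.mem_cons_self⟩
    have hdom₁ : h₁.dom = {s a.src} := hdom
    have hunion : {v | (h₁.get v).or (h₂.get v) ≠ none} = h₁.dom ∪ h₂.dom := by
      ext v
      simp only [ne_eq, Option.or_eq_none_iff, Heap.dom, Set.mem_ofPred_eq, Set.mem_union]
      tauto
    refine ⟨⟨fun v => (h₁.get v).or (h₂.get v), ?_, ?_⟩, h₁, h₂, ⟨?_, fun v => rfl⟩,
      ⟨hdom₁, by simp [h₁]⟩, hL⟩
    · exact hunion ▸ h₁.finite_dom.union h₂.finite_dom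
    · exact hunion ▸ Set.union_subset h₁.dom_loc h₂.dom_loc
    · rw [hdom₁, Set.disjoint_singleton_left, hL.mem_dom]
      rintro ⟨p, hp, hps⟩
      exact hnd.1 (List.mem_map.2 ⟨p, hp, hps⟩)

end Semantics

/-- The constraints imposed by the body of a symbolic heap. A pair `[a, b]` is a sublist of the
list of sources if `a` and `b` are the sources of two different points-to assertions. -/
def SymbolicHeap.constraints (τ : SymbolicHeap) : ConstraintSystem Var where
  eq a b := .eq a b ∈ τ.pure
  ne a b := .ne a b ∈ τ.pure ∨ (a = .null ∧ b ∈ τ.spatial.map PointsTo.src) ∨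
    [a, b] <+ τ.spatial.map PointsTo.src ∨ [b, a] <+ τ.spatial.map PointsTo.src
  al a := a ∈ τ.spatial.map PointsTo.src
  pt a b := ∃ p ∈ τ.spatial, p.src = a ∧ b ∈ p.tgt

theorem SymbolicHeap.WellFormed.supportedOn {τ : SymbolicHeap} (hτ : τ.WellFormed) :
    τ.constraints.SupportedOn τ.vars := by
  have hsrc : ∀ a ∈ τ.spatial.map PointsTo.src, a ∈ τ.vars := by
    simpa using fun p hp => hτ.spatial_src p hp
  have hpair : ∀ a b, [a, b] <+ τ.spatial.map PointsTo.src → a ∈ τ.vars ∧ b ∈ τ.vars :=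
    fun a b h => ⟨hsrc a (h.subset (by simp)), hsrc b (h.subset (by simp))⟩
  refine ⟨fun h => hτ.pure_vars _ h, ?_, fun h => hsrc _ h, ?_⟩
  · rintro u v (h | ⟨rfl, h⟩ | h | h)
    · exact hτ.pure_vars _ h
    · exact ⟨trivial, hsrc v h⟩
    · exact hpair u v h
    · exact (hpair v u h).symm
  · rintro u v ⟨p, hp, rfl, hv⟩
    exact ⟨hτ.spatial_src p hp, hτ.spatial_tgt p hp v hv⟩

section Models

variable {Val : Type*} {M : MemoryModel Val} {τ : SymbolicHeap} {x y : Var}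

namespace SymbolicHeap.BodySat

variable {s : Var → Val} {h : Heap M}

theorem eq_of_equal (hs : τ.BodySat s h) (hxy : τ.constraints.Equal x y) : s x = s y := by
  induction hxy with
  | refl => rfl
  | tail _ h ih =>
    rw [ih]
    rcases h with h | h
    · exact hs.2.2 _ h
    · exact (hs.2.2 _ h).symm

theorem ne_of_sublist (hs : τ.BodySat s h) (hxy : [x, y] <+ τ.spatial.map PointsTo.src) :
    s x ≠ s y := by
  have hnd := hs.2.1.spec.1
  have := (hxy.map s).nodup (by simpa [Function.comp_def] using hnd)
  simpa using this

theorem ne_of_ne (hs : τ.BodySat s h) (hxy : τ.constraints.ne x y) : s x ≠ s y := by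
  rcases hxy with h | ⟨rfl, h⟩ | h | h
  · exact hs.2.2 _ h
  · obtain ⟨p, hp, rfl⟩ := List.mem_map.1 h
    rw [hs.1]
    exact fun h => M.nil_not_loc (h ▸ hs.2.1.spec.2.1 p hp)
  · exact hs.ne_of_sublist h
  · exact (hs.ne_of_sublist h).symm

theorem ne_of_unequal (hs : τ.BodySat s h) (hxy : τ.constraints.Unequal x y) : s x ≠ s y := by
  obtain ⟨u, v, h | h, hx, hy⟩ := hxy
  · rw [hs.eq_of_equal hx, hs.eq_of_equal hy]; exact hs.ne_of_ne h
  · rw [hs.eq_of_equal hx, hs.eq_of_equal hy]; exact (hs.ne_of_ne h).symm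

theorem not_inconsistent (hs : τ.BodySat s h) : ¬ τ.constraints.Inconsistent :=
  fun ⟨_, _, hne, heq⟩ => hs.ne_of_ne hne (hs.eq_of_equal heq)

theorem mem_dom_of_alloc (hs : τ.BodySat s h) (hx : τ.constraints.Alloc x) : s x ∈ h.dom := by
  obtain ⟨u, hu, hx⟩ := hx
  obtain ⟨p, hp, rfl⟩ := List.mem_map.1 hu
  rw [hs.eq_of_equal hx, hs.2.1.mem_dom]
  exact ⟨p, hp, rfl⟩

theorem pointsTo_of_step (hs : τ.BodySat s h) (hxy : τ.constraints.Step x y) :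
    ∃ t, h.get (s x) = some t ∧ s y ∈ t := by
  obtain ⟨u, v, ⟨p, hp, rfl, hv⟩, hx, hy⟩ := hxy
  refine ⟨p.tgt.map s, ?_, ?_⟩
  · rw [hs.eq_of_equal hx, hs.2.1.spec.2.2]
    exact ⟨p, hp, rfl, rfl⟩
  · rw [hs.eq_of_equal hy]
    exact List.mem_map_of_mem hv

end SymbolicHeap.BodySat

instance : Countable Var := Var.equiv.injective.countable

/-- Each equivalence relation that respects the constraints is the equality of values in some
model: there are enough locations to give different values to different classes. -/
theorem exists_bodySat_iff (M : MemoryModel Val) (r : Setoid Var)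
    (heq : ∀ a b, τ.constraints.eq a b → r a b) (hne : ∀ a b, τ.constraints.ne a b → ¬ r a b) :
    ∃ (s : Var → Val) (h : Heap M), τ.BodySat s h ∧ ∀ x y, s x = s y ↔ r x y := by
  classical
  obtain ⟨g, hg⟩ := exists_injective_nat (Quotient r)
  let e := M.loc_infinite.natEmbedding
  let s : Var → Val := fun x => if r x .null then M.nil else e (g ⟦x⟧)
  have hnil : ∀ n, (e n : Val) ≠ M.nil := fun n h => M.nil_not_loc (h ▸ (e n).2)
  have hs : ∀ x y, s x = s y ↔ r x y := by
    intro x y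
    by_cases hx : r x .null <;> by_cases hy : r y .null
    · simpa [s, hx, hy] using r.trans hx (r.symm hy)
    · simp only [s, hx, hy, if_true, if_false]
      exact ⟨fun h => absurd h.symm (hnil _), fun h => absurd (r.trans (r.symm h) hx) hy⟩
    · simp only [s, hx, hy, if_true, if_false]
      exact ⟨fun h => absurd h (hnil _), fun h => absurd (r.trans h hy) hx⟩
    · simp only [s, hx, hy, if_false]
      rw [Subtype.val_injective.eq_iff, e.injective.eq_iff, hg.eq_iff, Quotient.eq]
  have hnd : (τ.spatial.map fun p => s p.src).Nodup := by
    have : (τ.spatial.map PointsTo.src).Pairwise fun a b => s a ≠ s b :=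
      List.pairwise_iff_forall_sublist.2 fun h =>
        fun h' => hne _ _ (.inr (.inr (.inl h))) ((hs _ _).1 h')
    simpa [List.Nodup, List.pairwise_map] using this
  have hloc : ∀ p ∈ τ.spatial, s p.src ∈ M.Loc := by
    intro p hp
    have : ¬ r p.src .null := fun h =>
      hne .null p.src (.inr (.inl ⟨rfl, List.mem_map_of_mem hp⟩)) (r.symm h)
    simp [s, this]
  obtain ⟨h, hh⟩ := exists_spatialSat hnd hloc
  refine ⟨s, h, ⟨by simp [s], hh, ?_⟩, hs⟩
  rintro (⟨a, b⟩ | ⟨a, b⟩) hπ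
  · exact (hs a b).2 (heq a b hπ)
  · exact fun h => hne a b (.inl hπ) ((hs a b).1 h)

/-- A most general model: only those variables are equal that have to be. -/
theorem exists_bodySat_iff_equal (M : MemoryModel Val) (hτ : ¬ τ.constraints.Inconsistent) :
    ∃ (s : Var → Val) (h : Heap M), τ.BodySat s h ∧
      ∀ x y, s x = s y ↔ τ.constraints.Equal x y :=
  exists_bodySat_iff M ⟨τ.constraints.Equal, ⟨.refl, .symm, .trans⟩⟩ (fun _ _ h => .of_eq h)
    fun a b h h' => hτ ⟨a, b, h, h'⟩

/-- Two variables can be identified unless they are required to be unequal. -/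
theorem exists_bodySat_eq (M : MemoryModel Val) (hτ : ¬ τ.constraints.Inconsistent)
    (hxy : ¬ τ.constraints.Unequal x y) :
    ∃ (s : Var → Val) (h : Heap M), τ.BodySat s h ∧ s x = s y := by
  -- The equivalence relation generated by `Equal` and the pair `(x, y)` merges two classes.
  let r : Setoid Var :=
    ⟨fun a b => τ.constraints.Equal a b ∨
      ((τ.constraints.Equal a x ∨ τ.constraints.Equal a y) ∧
        (τ.constraints.Equal b x ∨ τ.constraints.Equal b y)),
     ⟨fun a => .inl (.refl a), fun h => h.imp .symm fun h => ⟨h.2, h.1⟩, fun {a b c} h h' => by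
      rcases h with h | ⟨h1, h2⟩ <;> rcases h' with h' | ⟨h3, h4⟩
      · exact .inl (h.trans h')
      · exact .inr ⟨h3.imp h.trans h.trans, h4⟩
      · exact .inr ⟨h1, h2.imp h'.symm.trans h'.symm.trans⟩
      · exact .inr ⟨h1, h4⟩⟩⟩
  obtain ⟨s, h, hs, hr⟩ := exists_bodySat_iff M (τ := τ) r (fun a b h => .inl (.of_eq h)) (by
    rintro a b hne (h | ⟨h1 | h1, h2 | h2⟩)
    · exact hτ ⟨a, b, hne, h⟩
    · exact hτ ⟨a, b, hne, h1.trans h2.symm⟩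
    · exact hxy ⟨a, b, .inl hne, h1.symm, h2.symm⟩
    · exact hxy ⟨b, a, .inr hne, h2.symm, h1.symm⟩
    · exact hτ ⟨a, b, hne, h1.trans h2.symm⟩)
  exact ⟨s, h, hs, (hr x y).2 (.inr ⟨.inl (.refl x), .inr (.refl y)⟩)⟩

variable (M τ x y)

theorem defEq_iff :
    DefEq M τ x y ↔ τ.constraints.Inconsistent ∨ τ.constraints.Equal x y := by
  refine ⟨fun h => ?_, ?_⟩
  · by_contra! hc
    obtain ⟨s, hp, hs, he⟩ := exists_bodySat_iff_equal M hc.1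
    exact hc.2 ((he x y).1 (h s hp hs))
  · rintro (hc | he) s h hs
    · exact absurd hc hs.not_inconsistent
    · exact hs.eq_of_equal he

theorem defNe_iff :
    DefNe M τ x y ↔ τ.constraints.Inconsistent ∨ τ.constraints.Unequal x y := by
  refine ⟨fun h => ?_, ?_⟩
  · by_contra! hc
    obtain ⟨s, hp, hs, he⟩ := exists_bodySat_eq M hc.1 hc.2
    exact h s hp hs he
  · rintro (hc | hne) s h hs
    · exact absurd hc hs.not_inconsistent
    · exact hs.ne_of_unequal hne

theorem defAlloc_iff :
    DefAlloc M τ x ↔ τ.constraints.Inconsistent ∨ τ.constraints.Alloc x := by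
  refine ⟨fun h => ?_, ?_⟩
  · by_contra! hc
    obtain ⟨s, hp, hs, he⟩ := exists_bodySat_iff_equal M hc.1
    obtain ⟨p, hp, hpx⟩ := (hs.2.1.mem_dom _).1 (h s hp hs)
    exact hc.2 ⟨p.src, List.mem_map_of_mem hp, ((he _ _).1 hpx).symm⟩
  · rintro (hc | ha) s h hs
    · exact absurd hc hs.not_inconsistent
    · exact hs.mem_dom_of_alloc ha

theorem defPointsTo_iff :
    DefPointsTo M τ x y ↔ τ.constraints.Inconsistent ∨ τ.constraints.Step x y := by
  refine ⟨fun h => ?_, ?_⟩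
  · by_contra! hc
    obtain ⟨s, hp, hs, he⟩ := exists_bodySat_iff_equal M hc.1
    obtain ⟨t, ht, hy⟩ := h s hp hs
    obtain ⟨p, hp, hpx, rfl⟩ := (hs.2.1.spec.2.2 _ _).1 ht
    obtain ⟨z, hz, hzy⟩ := List.mem_map.1 hy
    exact hc.2 ⟨p.src, z, ⟨p, hp, rfl, hz⟩, ((he _ _).1 hpx).symm, ((he _ _).1 hzy).symm⟩
  · rintro (hc | ha) s h hs
    · exact absurd hc hs.not_inconsistent
    · exact hs.pointsTo_of_step ha

variable {τ x y}

theorem defReach_iff (hτ : τ.WellFormed) (hx : x ∈ τ.vars) (hy : y ∈ τ.vars) :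
    DefReach M τ x y ↔ τ.constraints.Inconsistent ∨ τ.constraints.Reach x y := by
  by_cases hc : τ.constraints.Inconsistent
  · exact iff_of_true (.single ⟨hx, hy, (defPointsTo_iff M τ x y).2 (.inl hc)⟩) (.inl hc)
  · have : (fun x y => x ∈ τ.vars ∧ y ∈ τ.vars ∧ DefPointsTo M τ x y) = τ.constraints.Step := by
      ext a b
      simp only [defPointsTo_iff, hc, false_or]
      exact ⟨fun h => h.2.2, fun h => ⟨(h.mem hτ.supportedOn).1, (h.mem hτ.supportedOn).2, h⟩⟩
    simp only [DefReach, hc, false_or]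
    rw [this]
    rfl

end Models

/-! ### Replacement of predicate calls -/

/-- The set of all variables of symbolic heaps with `n` free and `k` quantified variables. -/
def scope (n k : ℕ) : Set Var :=
  {x | x.InScope n k}

theorem scope_mono (n : ℕ) {k k' : ℕ} (h : k ≤ k') : scope n k ⊆ scope n k' := by
  rintro (_ | i | j) hx
  · trivial
  · exact hx
  · exact lt_of_lt_of_le (show j < k from hx) h

theorem mem_scope_zero {n : ℕ} {x : Var} : x ∈ scope n 0 ↔ ∃ i ≤ n, x = param i := by
  constructor
  · rcases x with _ | i | j
    · exact fun _ => ⟨0, Nat.zero_le n, rfl⟩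
    · exact fun h => ⟨i + 1, h, rfl⟩
    · exact fun h => absurd h (Nat.not_lt_zero j)
  · rintro ⟨_ | i, hi, rfl⟩
    · trivial
    · exact hi

theorem Var.inst_mem_scope {args : List Var} {n k m l : ℕ} {x : Var}
    (hargs : ∀ y ∈ args, y ∈ scope n k) (hx : x ∈ scope m l) :
    x.inst args k ∈ scope n (k + l) := by
  rcases x with _ | i | j
  · trivial
  · refine scope_mono n (Nat.le_add_right k l) ?_
    show args.getD i .null ∈ scope n k
    rw [List.getD_eq_getElem?_getD]
    rcases h : args[i]? with _ | y
    · trivial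
    · exact hargs y (List.mem_of_getElem? h)
  · exact Nat.add_lt_add_left hx k

theorem SymbolicHeap.WellFormed.plug {ψ τ : SymbolicHeap} {args : List Var} (hψ : ψ.WellFormed)
    (hτ : τ.WellFormed) (hargs : ∀ y ∈ args, y ∈ ψ.vars) : (ψ.plug args τ).WellFormed := by
  have hl : ∀ y ∈ ψ.vars, y ∈ (ψ.plug args τ).vars :=
    fun y hy => scope_mono _ (Nat.le_add_right _ _) hy
  have hr : ∀ y ∈ τ.vars, y.inst args ψ.numBound ∈ (ψ.plug args τ).vars :=
    fun y hy => Var.inst_mem_scope hargs hy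
  constructor
  · intro a ha
    rcases List.mem_append.1 ha with ha | ha
    · exact hl _ (hψ.spatial_src a ha)
    · obtain ⟨b, hb, rfl⟩ := List.mem_map.1 ha
      exact hr _ (hτ.spatial_src b hb)
  · intro a ha y hy
    rcases List.mem_append.1 ha with ha | ha
    · exact hl _ (hψ.spatial_tgt a ha y hy)
    · obtain ⟨b, hb, rfl⟩ := List.mem_map.1 ha
      obtain ⟨z, hz, rfl⟩ := List.mem_map.1 hy
      exact hr _ (hτ.spatial_tgt b hb z hz)
  · intro c hc
    rcases List.mem_append.1 hc with hc | hc
    · exact hψ.calls_arity c hc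
    · obtain ⟨d, hd, rfl⟩ := List.mem_map.1 hc
      simpa [Call.inst] using hτ.calls_arity d hd
  · intro c hc y hy
    rcases List.mem_append.1 hc with hc | hc
    · exact hl _ (hψ.calls_args c hc y hy)
    · obtain ⟨d, hd, rfl⟩ := List.mem_map.1 hc
      obtain ⟨z, hz, rfl⟩ := List.mem_map.1 hy
      exact hr _ (hτ.calls_args d hd z hz)
  · intro π hπ
    rcases Finset.mem_union.1 hπ with hπ | hπ
    · have := hψ.pure_vars π hπ
      rcases π with ⟨a, b⟩ | ⟨a, b⟩ <;> exact ⟨hl a this.1, hl b this.2⟩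
    · obtain ⟨ρ, hρ, rfl⟩ := Finset.mem_image.1 hπ
      have := hτ.pure_vars ρ hρ
      rcases ρ with ⟨a, b⟩ | ⟨a, b⟩ <;> exact ⟨hr a this.1, hr b this.2⟩

/-- The maps of the variables of two symbolic heaps, indexed by `false` and `true`, to those of
the heap that results when the second one is plugged into the first one. -/
def plugMap (args : List Var) (k : ℕ) (i : Bool) : Var → Var :=
  i.rec id (Var.inst args k)

theorem pair_sublist_append {α : Type*} {a b : α} {l₁ l₂ : List α} :
    [a, b] <+ l₁ ++ l₂ ↔ [a, b] <+ l₁ ∨ [a, b] <+ l₂ ∨ (a ∈ l₁ ∧ b ∈ l₂) := by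
  rw [List.sublist_append_iff]
  constructor
  · rintro ⟨_ | ⟨c, _ | ⟨d, m⟩⟩, m₂, h, h₁, h₂⟩
    · simp only [List.nil_append] at h
      exact .inr (.inl (h ▸ h₂))
    · simp only [List.cons_append, List.nil_append, List.cons.injEq] at h
      obtain ⟨rfl, rfl⟩ := h
      exact .inr (.inr ⟨by simpa using h₁, by simpa using h₂⟩)
    · simp only [List.cons_append, List.cons.injEq] at h
      obtain ⟨rfl, rfl, h⟩ := h
      simp only [List.nil_eq, List.append_eq_nil_iff] at h
      exact .inl (h.1 ▸ h₁)
  · rintro (h | h | ⟨h₁, h₂⟩)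
    · exact ⟨[a, b], [], by simp, h, by simp⟩
    · exact ⟨[], [a, b], by simp, by simp, h⟩
    · exact ⟨[a], [b], by simp, by simpa using h₁, by simpa using h₂⟩

theorem pair_sublist_map {α β : Type*} {g : α → β} {a b : β} {l : List α} :
    [a, b] <+ l.map g ↔ ∃ c d, [c, d] <+ l ∧ g c = a ∧ g d = b := by
  rw [List.sublist_map_iff]
  constructor
  · rintro ⟨l', hl', h⟩
    obtain ⟨c, d, rfl⟩ : ∃ c d, l' = [c, d] := by
      have := congrArg List.length h
      rw [List.length_map] at this
      exact List.length_eq_two.1 this.symm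
    simp only [List.map_cons, List.map_nil, List.cons.injEq, and_true] at h
    exact ⟨c, d, hl', h.1.symm, h.2.symm⟩
  · rintro ⟨c, d, h, rfl, rfl⟩
    exact ⟨[c, d], h, rfl⟩

/-- Plugging in glues the constraints; in particular, the sources of points-to assertions of
different components are different. -/
theorem constraints_plug (ψ τ : SymbolicHeap) (args : List Var) :
    (ψ.plug args τ).constraints =
      .glue (plugMap args ψ.numBound) (fun i : Bool => i.rec ψ.constraints τ.constraints) := by
  have hsrc : (ψ.plug args τ).spatial.map PointsTo.src = ψ.spatial.map PointsTo.src ++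
      (τ.spatial.map PointsTo.src).map (Var.inst args ψ.numBound) := by
    simp [SymbolicHeap.plug, PointsTo.inst, Function.comp_def]
  ext x y
  · simp only [SymbolicHeap.constraints, ConstraintSystem.glue, Bool.exists_bool, plugMap, id,
      SymbolicHeap.plug, Finset.mem_union, Finset.mem_image]
    refine or_congr (by simp) ⟨?_, ?_⟩
    · rintro ⟨⟨a, b⟩ | ⟨a, b⟩, h, he⟩
      · simp only [PureFormula.inst, PureFormula.eq.injEq] at he
        exact ⟨a, b, h, he⟩
      · simp [PureFormula.inst] at he
    · rintro ⟨a, b, h, rfl, rfl⟩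
      exact ⟨_, h, rfl⟩
  · have hne : .ne x y ∈ (ψ.plug args τ).pure ↔ .ne x y ∈ ψ.pure ∨ ∃ a b, .ne a b ∈ τ.pure ∧
        a.inst args ψ.numBound = x ∧ b.inst args ψ.numBound = y := by
      simp only [SymbolicHeap.plug, Finset.mem_union, Finset.mem_image]
      refine or_congr Iff.rfl ⟨?_, ?_⟩
      · rintro ⟨⟨a, b⟩ | ⟨a, b⟩, h, he⟩
        · simp [PureFormula.inst] at he
        · simp only [PureFormula.inst, PureFormula.ne.injEq] at he
          exact ⟨a, b, h, he⟩
      · rintro ⟨a, b, h, rfl, rfl⟩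
        exact ⟨_, h, rfl⟩
    simp only [SymbolicHeap.constraints, ConstraintSystem.glue, Bool.exists_bool, plugMap, id,
      hsrc, hne, pair_sublist_append, pair_sublist_map (g := Var.inst args ψ.numBound),
      List.mem_append, List.mem_map (f := Var.inst args ψ.numBound)]
    constructor
    · rintro ((h | ⟨a, b, h, rfl, rfl⟩) | ⟨rfl, h | ⟨b, h, rfl⟩⟩ |
        (h | ⟨a, b, h, rfl, rfl⟩ | ⟨h, b, h', rfl⟩) | (h | ⟨b, a, h, rfl, rfl⟩ | ⟨h, b, h', rfl⟩))
      · exact .inl (.inl ⟨x, y, .inl h, rfl, rfl⟩)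
      · exact .inl (.inr ⟨a, b, .inl h, rfl, rfl⟩)
      · exact .inl (.inl ⟨.null, y, .inr (.inl ⟨rfl, h⟩), rfl, rfl⟩)
      · exact .inl (.inr ⟨.null, b, .inr (.inl ⟨rfl, h⟩), rfl, rfl⟩)
      · exact .inl (.inl ⟨x, y, .inr (.inr (.inl h)), rfl, rfl⟩)
      · exact .inl (.inr ⟨a, b, .inr (.inr (.inl h)), rfl, rfl⟩)
      · exact .inr (.inl (.inr ⟨x, b, by simp, h, h', rfl, rfl⟩))
      · exact .inl (.inl ⟨x, y, .inr (.inr (.inr h)), rfl, rfl⟩)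
      · exact .inl (.inr ⟨a, b, .inr (.inr (.inr h)), rfl, rfl⟩)
      · exact .inr (.inr (.inl ⟨b, y, by simp, h', h, rfl, rfl⟩))
    · rintro ((⟨_, _, h, rfl, rfl⟩ | ⟨a, b, h, rfl, rfl⟩) |
        (⟨_, _, h, _⟩ | ⟨a, b, -, ha, hb, rfl, rfl⟩) | ⟨a, b, -, ha, hb, rfl, rfl⟩ | ⟨_, _, h, _⟩)
      · rcases h with h | ⟨rfl, h⟩ | h | h
        · exact .inl (.inl h)
        · exact .inr (.inl ⟨rfl, .inl h⟩)
        · exact .inr (.inr (.inl (.inl h)))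
        · exact .inr (.inr (.inr (.inl h)))
      · rcases h with h | ⟨rfl, h⟩ | h | h
        · exact .inl (.inr ⟨a, b, h, rfl, rfl⟩)
        · exact .inr (.inl ⟨rfl, .inr ⟨b, h, rfl⟩⟩)
        · exact .inr (.inr (.inl (.inr (.inl ⟨a, b, h, rfl, rfl⟩))))
        · exact .inr (.inr (.inr (.inr (.inl ⟨b, a, h, rfl, rfl⟩))))
      · exact absurd rfl h
      · exact .inr (.inr (.inl (.inr (.inr ⟨ha, b, hb, rfl⟩))))
      · exact .inr (.inr (.inr (.inr (.inr ⟨hb, a, ha, rfl⟩))))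
      · exact absurd rfl h
  · simp only [SymbolicHeap.constraints, hsrc, ConstraintSystem.glue, Bool.exists_bool, plugMap,
      id, List.mem_append, List.mem_map (f := Var.inst args ψ.numBound), exists_eq_right]
  · simp only [SymbolicHeap.constraints, ConstraintSystem.glue, Bool.exists_bool, plugMap, id,
      SymbolicHeap.plug, List.mem_append, List.mem_map]
    constructor
    · rintro ⟨p, hp | ⟨p, hp, rfl⟩, rfl, hy⟩
      · exact .inl ⟨p.src, y, ⟨p, hp, rfl, hy⟩, rfl, rfl⟩
      · obtain ⟨z, hz, rfl⟩ := List.mem_map.1 hy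
        exact .inr ⟨p.src, z, ⟨p, hp, rfl, hz⟩, rfl, rfl⟩
    · rintro (⟨_, _, ⟨p, hp, rfl, hy⟩, rfl, rfl⟩ | ⟨_, z, ⟨p, hp, rfl, hz⟩, rfl, rfl⟩)
      · exact ⟨p, .inl hp, rfl, hy⟩
      · exact ⟨_, .inr ⟨p, hp, rfl⟩, rfl, List.mem_map_of_mem hz⟩

open ConstraintSystem (EntailedOn)

/-- The plugged-in heap shares variables with its context only via its parameters. -/
theorem plug_interface {ψ τ : SymbolicHeap} {args : List Var} {k : ℕ} (hψ : ψ.WellFormed)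
    (hτ : τ.WellFormed) (hk : k ≤ ψ.numBound) (hargs : ∀ y ∈ args, y ∈ scope ψ.numFree k) :
    ConstraintSystem.Interface (plugMap args ψ.numBound)
      (fun i : Bool => i.rec ψ.constraints τ.constraints) (fun i : Bool => i.rec ψ.vars τ.vars)
      (fun i : Bool => i.rec (scope ψ.numFree k) (scope τ.numFree 0)) := by
  -- Parameters are mapped to visible variables, quantified variables are renamed apart.
  have hcases : ∀ x ∈ τ.vars,
      (x ∈ scope τ.numFree 0 ∧ x.inst args ψ.numBound ∈ scope ψ.numFree k) ∨
      (∃ j, x = .bound j ∧ x.inst args ψ.numBound = .bound (ψ.numBound + j)) := by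
    rintro (_ | i | j) hx
    · exact .inl ⟨trivial, trivial⟩
    · exact .inl ⟨hx, Var.inst_mem_scope (k := k) (l := 0) hargs
        (show Var.free i ∈ scope τ.numFree 0 from hx)⟩
    · exact .inr ⟨j, rfl, rfl⟩
  have hfresh : ∀ j, Var.bound (ψ.numBound + j) ∉ ψ.vars :=
    fun j hj => absurd (show ψ.numBound + j < ψ.numBound from hj) (by omega)
  have hvis : scope ψ.numFree k ⊆ ψ.vars := scope_mono _ hk
  refine ⟨?_, ?_, ?_⟩
  · rintro (_ | _)
    · exact hψ.supportedOn
    · exact hτ.supportedOn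
  · rintro (_ | _)
    · exact hvis
    · exact scope_mono _ (Nat.zero_le _)
  · rintro (_ | _) (_ | _) u v hu hv huv
    · exact .inl ⟨rfl, huv⟩
    · replace huv : u = v.inst args ψ.numBound := huv
      rcases hcases v hv with ⟨h1, h2⟩ | ⟨j, -, h⟩
      · exact .inr ⟨huv ▸ h2, h1⟩
      · exact absurd (show u ∈ ψ.vars from hu) (by rw [huv, h]; exact hfresh j)
    · replace huv : u.inst args ψ.numBound = v := huv
      rcases hcases u hu with ⟨h1, h2⟩ | ⟨j, -, h⟩
      · exact .inr ⟨h1, huv ▸ h2⟩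
      · exact absurd (show v ∈ ψ.vars from hv) (by rw [← huv, h]; exact hfresh j)
    · replace huv : u.inst args ψ.numBound = v.inst args ψ.numBound := huv
      rcases hcases u hu with ⟨h1, h2⟩ | ⟨j, rfl, h⟩ <;>
        rcases hcases v hv with ⟨h3, h4⟩ | ⟨l, rfl, h'⟩
      · exact .inr ⟨h1, h3⟩
      · exact absurd (hvis h2) (by rw [huv, h']; exact hfresh l)
      · exact absurd (hvis h4) (by rw [← huv, h]; exact hfresh j)
      · rw [h, h'] at huv
        simp only [Var.bound.injEq, Nat.add_left_cancel_iff] at huv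
        exact .inl ⟨rfl, congrArg _ huv⟩

theorem EntailedOn.plug {ψ ψ' τ τ' : SymbolicHeap} {args : List Var} {k : ℕ}
    (hψ : ψ.WellFormed) (hτ : τ.WellFormed) (hk : k ≤ ψ.numBound)
    (hargs : ∀ y ∈ args, y ∈ scope ψ.numFree k)
    (h : EntailedOn (scope ψ.numFree k) ψ.constraints ψ'.constraints)
    (h' : EntailedOn (scope τ.numFree 0) τ.constraints τ'.constraints) :
    EntailedOn (scope ψ.numFree k) (ψ.plug args τ).constraints (ψ'.plug args τ').constraints := by
  rw [constraints_plug, constraints_plug]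
  refine ConstraintSystem.EntailedOn.mono ?_ (ConstraintSystem.EntailedOn.glue
    (f' := plugMap args ψ'.numBound) (plug_interface hψ hτ hk hargs) ?_ ?_)
  · exact fun x hx => ⟨false, x, hx, rfl⟩
  · rintro (_ | _) v hv
    · rfl
    · rcases v with _ | i | j
      · rfl
      · rfl
      · exact absurd hv (Nat.not_lt_zero j)
  · rintro (_ | _)
    · exact h
    · exact h'

theorem foldl_plug_numFree (L : List (Call × SymbolicHeap)) (ψ : SymbolicHeap) :
    (L.foldl (fun ψ c => ψ.plug c.1.args c.2) ψ).numFree = ψ.numFree := by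
  induction L generalizing ψ with
  | nil => rfl
  | cons c L ih => exact ih _

theorem foldl_plug_reduced {L : List (Call × SymbolicHeap)} (hL : ∀ c ∈ L, c.2.Reduced)
    {ψ : SymbolicHeap} (hψ : ψ.Reduced) :
    (L.foldl (fun ψ c => ψ.plug c.1.args c.2) ψ).Reduced := by
  induction L generalizing ψ with
  | nil => exact hψ
  | cons c L ih =>
    refine ih (fun d hd => hL d (List.mem_cons_of_mem _ hd)) ?_
    have h1 : ψ.calls = [] := hψ
    have h2 : c.2.calls = [] := hL c List.mem_cons_self
    simp [SymbolicHeap.Reduced, SymbolicHeap.plug, h1, h2]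

theorem foldl_plug_wellFormed {L : List (Call × SymbolicHeap)} {n k : ℕ}
    (hL : ∀ c ∈ L, c.2.WellFormed ∧ ∀ y ∈ c.1.args, y ∈ scope n k)
    {ψ : SymbolicHeap} (hn : ψ.numFree = n) (hk : k ≤ ψ.numBound) (hψ : ψ.WellFormed) :
    (L.foldl (fun ψ c => ψ.plug c.1.args c.2) ψ).WellFormed := by
  subst hn
  induction L generalizing ψ with
  | nil => exact hψ
  | cons c L ih =>
    obtain ⟨h1, h2⟩ := hL c List.mem_cons_self
    exact ih (ψ := ψ.plug c.1.args c.2) (hψ := hψ.plug h1 fun y hy => scope_mono _ hk (h2 y hy))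
      (hk := le_add_right hk) (hL := fun d hd => hL d (List.mem_cons_of_mem _ hd))

theorem replace_mem_RSL {α : ℕ} {φ : SymbolicHeap} {τs : List SymbolicHeap} (hφ : φ ∈ SL α)
    (hτs : ∀ τ ∈ τs, τ.WellFormed ∧ τ.Reduced) : φ.replace τs ∈ RSL α := by
  refine ⟨⟨foldl_plug_wellFormed (n := φ.numFree) (k := φ.numBound) (fun c hc => ?_) rfl le_rfl
    ⟨hφ.1.spatial_src, hφ.1.spatial_tgt, by simp, by simp, hφ.1.pure_vars⟩,
    (foldl_plug_numFree _ _).trans_le hφ.2⟩, foldl_plug_reduced (fun c hc => ?_) rfl⟩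
  · have := List.of_mem_zip hc
    exact ⟨(hτs _ this.2).1, hφ.1.calls_args _ this.1⟩
  · exact (hτs _ (List.of_mem_zip hc).2).2

theorem EntailedOn.foldl_plug {n k : ℕ} {cs : List Call}
    (hcs : ∀ c ∈ cs, ∀ y ∈ c.args, y ∈ scope n k) {τs τs' : List SymbolicHeap}
    (hτs : List.Forall₂ (fun τ τ' => τ.WellFormed ∧
      EntailedOn (scope τ.numFree 0) τ.constraints τ'.constraints) τs τs')
    {ψ ψ' : SymbolicHeap} (hψ : ψ.WellFormed) (hn : ψ.numFree = n) (hk : k ≤ ψ.numBound)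
    (h : EntailedOn (scope n k) ψ.constraints ψ'.constraints) :
    EntailedOn (scope n k)
      ((cs.zip τs).foldl (fun ψ c => ψ.plug c.1.args c.2) ψ).constraints
      ((cs.zip τs').foldl (fun ψ c => ψ.plug c.1.args c.2) ψ').constraints := by
  subst hn
  induction hτs generalizing cs ψ ψ' with
  | nil => simpa using h
  | @cons τ τ' _ _ hτ _ ih =>
    rcases cs with _ | ⟨c, cs⟩
    · exact h
    · have hc := hcs c List.mem_cons_self
      have hp := EntailedOn.plug hψ hτ.1 hk hc h hτ.2
      have hw := hψ.plug hτ.1 fun y hy => scope_mono _ hk (hc y hy)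
      exact ih hw (le_add_right hk) (fun d hd => hcs d (List.mem_cons_of_mem _ hd)) hp

theorem EntailedOn.replace {φ : SymbolicHeap} (hφ : φ.WellFormed) {τs τs' : List SymbolicHeap}
    (hτs : List.Forall₂ (fun τ τ' => τ.WellFormed ∧
      EntailedOn (scope τ.numFree 0) τ.constraints τ'.constraints) τs τs') :
    EntailedOn (scope φ.numFree φ.numBound) (φ.replace τs).constraints
      (φ.replace τs').constraints :=
  EntailedOn.foldl_plug (ψ := { φ with calls := [] }) (ψ' := { φ with calls := [] })
    hφ.calls_args hτs
    ⟨hφ.spatial_src, hφ.spatial_tgt, by simp, by simp, hφ.pure_vars⟩ rfl le_rfl (.refl _ _)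

/-! ### States -/

/-- What the automaton records about a reduced symbolic heap: the set of parameters that are
definitely allocated, and the sets of pairs `(i, j)` of parameters that are definitely equal, that
are definitely unequal, and for which the second one is definitely reachable from the first one.
The number of free variables can be read off the diagonal of the second component. -/
abbrev State (α : ℕ) : Type :=
  Set (Fin (α + 1)) × Set (Fin (α + 1) × Fin (α + 1)) × Set (Fin (α + 1) × Fin (α + 1)) ×
    Set (Fin (α + 1) × Fin (α + 1))

section State

variable {Val : Type*} (M : MemoryModel Val) {α : ℕ}

/-- The state of a reduced symbolic heap. -/
def stateOf (α : ℕ) (τ : SymbolicHeap) : State α :=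
  (allocSet M α τ, paramRel α τ (DefEq M τ), paramRel α τ (DefNe M τ),
    paramRel α τ (DefReach M τ))

theorem numFree_le_of_stateOf_eq {τ τ' : SymbolicHeap} (hτ : τ.numFree ≤ α)
    (h : stateOf M α τ = stateOf M α τ') : τ.numFree ≤ τ'.numFree := by
  have h2 : paramRel α τ (DefEq M τ) = paramRel α τ' (DefEq M τ') := congrArg (·.2.1) h
  let i : Fin (α + 1) := ⟨τ.numFree, Nat.lt_succ_of_le hτ⟩
  have : (i, i) ∈ paramRel α τ (DefEq M τ) := ⟨le_rfl, le_rfl, fun _ _ _ => rfl⟩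
  rw [h2] at this
  exact this.1

theorem numFree_eq_of_stateOf_eq {τ τ' : SymbolicHeap} (hτ : τ.numFree ≤ α)
    (hτ' : τ'.numFree ≤ α) (h : stateOf M α τ = stateOf M α τ') : τ.numFree = τ'.numFree :=
  (numFree_le_of_stateOf_eq M hτ h).antisymm (numFree_le_of_stateOf_eq M hτ' h.symm)

theorem inconsistent_iff_defNe (τ : SymbolicHeap) :
    τ.constraints.Inconsistent ↔ DefNe M τ .null .null := by
  rw [defNe_iff]
  exact ⟨.inl, fun h => h.elim id fun h => h.inconsistent (.refl _)⟩

theorem entailedOn_of_stateOf_eq {τ τ' : SymbolicHeap} (hτ : τ ∈ SL α) (hτ' : τ' ∈ SL α)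
    (h : stateOf M α τ = stateOf M α τ') :
    EntailedOn (scope τ.numFree 0) τ.constraints τ'.constraints := by
  have hn := numFree_eq_of_stateOf_eq M hτ.2 hτ'.2 h
  have hrel : ∀ {r r' : Var → Var → Prop}, paramRel α τ r = paramRel α τ' r' →
      ∀ x ∈ scope τ.numFree 0, ∀ y ∈ scope τ.numFree 0, r x y → r' x y := by
    intro r r' hr x hx y hy hxy
    obtain ⟨i, hi, rfl⟩ := mem_scope_zero.1 hx
    obtain ⟨j, hj, rfl⟩ := mem_scope_zero.1 hy
    have : ((⟨i, by have := hτ.2; omega⟩, ⟨j, by have := hτ.2; omega⟩) :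
        Fin (α + 1) × Fin (α + 1)) ∈ paramRel α τ r := ⟨hi, hj, hxy⟩
    rw [hr] at this
    exact this.2.2
  have hvars : ∀ {ψ : SymbolicHeap}, ψ.numFree = τ.numFree → scope τ.numFree 0 ⊆ ψ.vars :=
    fun hψ => hψ ▸ scope_mono _ (Nat.zero_le _)
  have h2 := hrel (congrArg (·.2.1) h)
  have h3 := hrel (congrArg (·.2.2.1) h)
  have h4 := hrel (congrArg (·.2.2.2) h)
  intro hc
  refine ⟨fun hc' => hc ?_, fun x hx y hy hxy => ?_, fun x hx y hy hxy => ?_, fun x hx hxa => ?_,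
    fun x hx y hy hxy => ?_⟩
  · rw [inconsistent_iff_defNe M] at hc' ⊢
    exact h3 .null trivial .null trivial hc'
  · exact ((defEq_iff M τ' x y).1 (h2 x hx y hy ((defEq_iff M τ x y).2 (.inr hxy)))).resolve_left hc
  · exact ((defNe_iff M τ' x y).1 (h3 x hx y hy ((defNe_iff M τ x y).2 (.inr hxy)))).resolve_left hc
  · obtain ⟨i, hi, rfl⟩ := mem_scope_zero.1 hx
    have : (⟨i, by have := hτ.2; omega⟩ : Fin (α + 1)) ∈ allocSet M α τ :=
      ⟨hi, (defAlloc_iff M τ _).2 (.inr hxa)⟩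
    rw [show allocSet M α τ = allocSet M α τ' from congrArg (·.1) h] at this
    exact ((defAlloc_iff M τ' _).1 this.2).resolve_left hc
  · exact ((defReach_iff M hτ'.1 (hvars hn.symm hx) (hvars hn.symm hy)).1 (h4 x hx y hy
      ((defReach_iff M hτ.1 (hvars rfl hx) (hvars rfl hy)).2 (.inr hxy)))).resolve_left hc

theorem stateOf_le_of_entailedOn {τ τ' : SymbolicHeap} (hτ : τ.WellFormed)
    (hτ' : τ'.WellFormed) (hn : τ.numFree = τ'.numFree)
    (h : EntailedOn (scope τ.numFree 0) τ.constraints τ'.constraints) :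
    stateOf M α τ ≤ stateOf M α τ' := by
  have hp : ∀ {i}, i ≤ τ.numFree → param i ∈ scope τ.numFree 0 :=
    fun hi => mem_scope_zero.2 ⟨_, hi, rfl⟩
  have hvars : ∀ {ψ : SymbolicHeap}, ψ.numFree = τ.numFree → scope τ.numFree 0 ⊆ ψ.vars :=
    fun hψ => hψ ▸ scope_mono _ (Nat.zero_le _)
  have key : ∀ {P Q : Prop}, (¬ τ'.constraints.Inconsistent → P → Q) →
      τ.constraints.Inconsistent ∨ P → τ'.constraints.Inconsistent ∨ Q := by
    intro P Q hPQ hP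
    by_cases hc : τ'.constraints.Inconsistent
    · exact .inl hc
    · exact .inr (hPQ hc (hP.resolve_left (h hc).1))
  refine ⟨?_, ?_, ?_, ?_⟩
  · rintro i ⟨hi, hx⟩
    refine ⟨hn ▸ hi, (defAlloc_iff M τ' _).2 (key ?_ ((defAlloc_iff M τ _).1 hx))⟩
    exact fun hc => (h hc).2.2.2.1 _ (hp hi)
  · rintro ⟨i, j⟩ ⟨hi, hj, hx⟩
    refine ⟨hn ▸ hi, hn ▸ hj, (defEq_iff M τ' _ _).2 (key ?_ ((defEq_iff M τ _ _).1 hx))⟩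
    exact fun hc => (h hc).2.1 _ (hp hi) _ (hp hj)
  · rintro ⟨i, j⟩ ⟨hi, hj, hx⟩
    refine ⟨hn ▸ hi, hn ▸ hj, (defNe_iff M τ' _ _).2 (key ?_ ((defNe_iff M τ _ _).1 hx))⟩
    exact fun hc => (h hc).2.2.1 _ (hp hi) _ (hp hj)
  · rintro ⟨i, j⟩ ⟨hi, hj, hx⟩
    refine ⟨hn ▸ hi, hn ▸ hj, (defReach_iff M hτ' (hvars hn.symm (hp hi))
      (hvars hn.symm (hp hj))).2 (key ?_ ((defReach_iff M hτ (hvars rfl (hp hi))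
        (hvars rfl (hp hj))).1 hx))⟩
    exact fun hc => (h hc).2.2.2.2 _ (hp hi) _ (hp hj)

/-- The state of a symbolic heap after the replacement of its predicate calls depends only on
the states of the heaps that replace them. -/
theorem stateOf_replace_congr {φ : SymbolicHeap} (hφ : φ ∈ SL α) {τs τs' : List SymbolicHeap}
    (hτs : List.Forall₂ (fun τ τ' => τ ∈ RSL α ∧ τ' ∈ RSL α ∧ stateOf M α τ = stateOf M α τ')
      τs τs') :
    stateOf M α (φ.replace τs) = stateOf M α (φ.replace τs') := by
  have key : ∀ {τs τs' : List SymbolicHeap}, List.Forall₂ (fun τ τ' => τ ∈ RSL α ∧ τ' ∈ RSL α ∧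
      stateOf M α τ = stateOf M α τ') τs τs' →
      stateOf M α (φ.replace τs) ≤ stateOf M α (φ.replace τs') := by
    intro τs τs' h
    have hl : ∀ τ ∈ τs, τ ∈ RSL α := by
      intro τ hτ
      obtain ⟨i, hi, rfl⟩ := List.mem_iff_getElem.1 hτ
      exact ((List.forall₂_iff_get.1 h).2 i hi (by rw [← h.length_eq]; exact hi)).1
    have hr : ∀ τ ∈ τs', τ ∈ RSL α := by
      intro τ hτ
      obtain ⟨i, hi, rfl⟩ := List.mem_iff_getElem.1 hτ
      exact ((List.forall₂_iff_get.1 h).2 i (by rw [h.length_eq]; exact hi) hi).2.1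
    have hL := replace_mem_RSL hφ fun τ hτ => ⟨(hl τ hτ).1.1, (hl τ hτ).2⟩
    have hR := replace_mem_RSL hφ fun τ hτ => ⟨(hr τ hτ).1.1, (hr τ hτ).2⟩
    have hnL : (φ.replace τs).numFree = φ.numFree := foldl_plug_numFree _ _
    have hnR : (φ.replace τs').numFree = φ.numFree := foldl_plug_numFree _ _
    refine stateOf_le_of_entailedOn M hL.1.1 hR.1.1 (hnL.trans hnR.symm) ?_
    refine ConstraintSystem.EntailedOn.mono (hnL ▸ scope_mono _ (Nat.zero_le _))
      (EntailedOn.replace hφ.1 (h.imp ?_))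
    exact fun τ τ' h => ⟨h.1.1.1, entailedOn_of_stateOf_eq M h.1.1 h.2.1.1 h.2.2⟩
  refine (key hτs).antisymm (key ?_)
  exact hτs.flip.imp fun τ τ' h => ⟨h.2.1, h.1, h.2.2.symm⟩

end State

/-! ### Primitive recursive predicates -/

section Primrec

variable {β γ : Type*} [Primcodable β] [Primcodable γ]

theorem primrecPred_exists_mem {f : β → List γ} {p : β → γ → Prop} (hf : Primrec f)
    (hp : PrimrecRel p) : PrimrecPred fun a => ∃ b ∈ f a, p a b :=
  (PrimrecRel.exists_mem_list (R := fun b a => p a b) hp.swap).comp hf Primrec.id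

theorem primrecPred_forall_mem {f : β → List γ} {p : β → γ → Prop} (hf : Primrec f)
    (hp : PrimrecRel p) : PrimrecPred fun a => ∀ b ∈ f a, p a b :=
  (PrimrecRel.forall_mem_list (R := fun b a => p a b) hp.swap).comp hf Primrec.id

theorem primrecPred_iff {p q : β → Prop} (hp : PrimrecPred p) (hq : PrimrecPred q) :
    PrimrecPred fun a => p a ↔ q a :=
  ((hp.and hq).or (hp.not.and hq.not)).of_eq fun a => by tauto

theorem primrecPred_forall_finite {ι : Type*} [Finite ι] {p : ι → β → Prop}
    (hp : ∀ i, PrimrecPred (p i)) : PrimrecPred fun a => ∀ i, p i a := by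
  classical
  have := Fintype.ofFinite ι
  suffices H : ∀ s : Finset ι, PrimrecPred fun a => ∀ i ∈ s, p i a from
    (H Finset.univ).of_eq fun a => by simp
  intro s
  induction s using Finset.induction_on with
  | empty => exact (Primrec.const true).primrecPred (p := fun _ => True) |>.of_eq fun a => by simp
  | insert i s _ ih => exact ((hp i).and ih).of_eq fun a => by simp

theorem primrecPred_of_finite [Finite γ] (p : γ → Prop) : PrimrecPred p := by
  classical
  exact (Primrec.dom_finite _).primrecPred

/-- The transitive closure of a finite relation: each new edge joins all predecessors of its source
to all successors of its target. -/
def transClosure [DecidableEq γ] (L : List (γ × γ)) : List (γ × γ) :=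
  L.foldr (fun e R => R ++ (e.1 :: (R.filter fun d => d.2 = e.1).map Prod.fst).flatMap fun a =>
    (e.2 :: (R.filter fun d => d.1 = e.2).map Prod.snd).map fun b => (a, b)) []

omit [Primcodable γ] in
theorem mem_transClosure [DecidableEq γ] {L : List (γ × γ)} {x y : γ} :
    (x, y) ∈ transClosure L ↔ Relation.TransGen (fun a b => (a, b) ∈ L) x y := by
  induction L generalizing x y with
  | nil => simpa [transClosure] using fun h => by induction h <;> assumption
  | cons e L ih =>
    obtain ⟨a, b⟩ := e
    have hmem : (x, y) ∈ transClosure ((a, b) :: L) ↔ (x, y) ∈ transClosure L ∨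
        (x = a ∨ (x, a) ∈ transClosure L) ∧ (y = b ∨ (b, y) ∈ transClosure L) := by
      conv_lhs => rw [transClosure, List.foldr_cons, ← transClosure]
      simp only [List.mem_append, List.mem_flatMap, List.mem_cons, List.mem_map, List.mem_filter,
        decide_eq_true_eq, Prod.exists, exists_and_right, exists_eq_right, Prod.mk.injEq]
      aesop
    rw [hmem]
    clear hmem
    simp only [ih]
    have hsub : ∀ {u v}, Relation.TransGen (fun c d => (c, d) ∈ L) u v →
        Relation.TransGen (fun c d => (c, d) ∈ (a, b) :: L) u v :=
      fun h => Relation.TransGen.mono (fun _ _ h => List.mem_cons_of_mem _ h) _ _ h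
    have hab : Relation.TransGen (fun c d => (c, d) ∈ (a, b) :: L) a b :=
      .single List.mem_cons_self
    constructor
    · rintro (h | ⟨rfl | h1, rfl | h2⟩)
      · exact hsub h
      · exact hab
      · exact hab.trans (hsub h2)
      · exact (hsub h1).trans hab
      · exact ((hsub h1).trans hab).trans (hsub h2)
    · intro h
      induction h with
      | single h =>
        rcases List.mem_cons.1 h with h | h
        · obtain ⟨rfl, rfl⟩ := Prod.mk.inj h
          exact .inr ⟨.inl rfl, .inl rfl⟩
        · exact .inl (.single h)
      | tail _ h ih =>
        rcases List.mem_cons.1 h with h | h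
        · obtain ⟨rfl, rfl⟩ := Prod.mk.inj h
          rcases ih with ih | ih
          · exact .inr ⟨.inr ih, .inl rfl⟩
          · exact .inr ⟨ih.1, .inl rfl⟩
        · rcases ih with ih | ⟨h1, h2 | h2⟩
          · exact .inl (ih.tail h)
          · exact .inr ⟨h1, .inr (h2 ▸ .single h)⟩
          · exact .inr ⟨h1, .inr (h2.tail h)⟩

theorem primrec_transClosure [DecidableEq γ] :
    Primrec (transClosure : List (γ × γ) → List (γ × γ)) := by
  refine Primrec.list_foldr (h := fun _ (p : (γ × γ) × List (γ × γ)) => p.2 ++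
    (p.1.1 :: (p.2.filter fun d => d.2 = p.1.1).map Prod.fst).flatMap fun a =>
      (p.1.2 :: (p.2.filter fun d => d.1 = p.1.2).map Prod.snd).map fun b => (a, b))
    Primrec.id (Primrec.const []) ?_
  have he : Primrec fun p : List (γ × γ) × (γ × γ) × List (γ × γ) => p.2.1 :=
    Primrec.fst.comp Primrec.snd
  have hR : Primrec fun p : List (γ × γ) × (γ × γ) × List (γ × γ) => p.2.2 :=
    Primrec.snd.comp Primrec.snd
  have hpre : PrimrecRel fun (d : γ × γ) (a : γ) => d.2 = a :=
    Primrec.eq.comp (Primrec.snd.comp Primrec.fst) Primrec.snd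
  have hsuc : PrimrecRel fun (d : γ × γ) (a : γ) => d.1 = a :=
    Primrec.eq.comp (Primrec.fst.comp Primrec.fst) Primrec.snd
  refine Primrec.list_append.comp hR (Primrec.list_flatMap ?_ (Primrec₂.mk ?_))
  · refine Primrec.list_cons.comp (Primrec.fst.comp he) (Primrec.list_map ?_
      (Primrec₂.mk (Primrec.fst.comp Primrec.snd)))
    exact hpre.listFilter.comp hR (Primrec.fst.comp he)
  · refine Primrec.list_map (Primrec.list_cons.comp (Primrec.snd.comp (he.comp Primrec.fst))
      (Primrec.list_map ?_ (Primrec₂.mk (Primrec.snd.comp Primrec.snd)))) (Primrec₂.mk ?_)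
    · exact hsuc.listFilter.comp (hR.comp Primrec.fst) (Primrec.snd.comp (he.comp Primrec.fst))
    · exact (Primrec.snd.comp Primrec.fst).pair Primrec.snd

/-- Reachability in a finite graph that is given by its list of edges is primitive recursive. -/
theorem primrecPred_reflTransGen [DecidableEq γ] {E : β → List (γ × γ)} {f g : β → γ}
    (hE : Primrec E) (hf : Primrec f) (hg : Primrec g) :
    PrimrecPred fun a => Relation.ReflTransGen (fun u v => (u, v) ∈ E a) (f a) (g a) := by
  have hmem : PrimrecPred fun a => ∃ e ∈ transClosure (E a), (f a, g a) = e :=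
    primrecPred_exists_mem (primrec_transClosure.comp hE)
      (Primrec.eq.comp ((hf.pair hg).comp Primrec.fst) Primrec.snd)
  refine ((Primrec.eq.comp hf hg).or hmem).of_eq fun a => ?_
  rw [Relation.reflTransGen_iff_eq_or_transGen, ← mem_transClosure, exists_eq_right',
    eq_comm (a := f a)]

/-- The pairs of entries of a list at different positions, in the order of the list. -/
def orderedPairs : List γ → List (γ × γ)
  | [] => []
  | a :: l => l.map (fun b => (a, b)) ++ orderedPairs l

omit [Primcodable γ] in
theorem mem_orderedPairs {l : List γ} {a b : γ} : (a, b) ∈ orderedPairs l ↔ [a, b] <+ l := by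
  induction l with
  | nil => simp [orderedPairs]
  | cons c l ih =>
    simp only [orderedPairs, List.mem_append, List.mem_map, Prod.mk.injEq, ih,
      List.sublist_cons_iff (a := c)]
    simp only [List.cons.injEq, exists_eq_right_right]
    constructor
    · rintro (⟨h, rfl⟩ | h)
      · exact .inr ⟨[b], ⟨rfl, rfl⟩, by simpa using h⟩
      · exact .inl h
    · rintro (h | ⟨r, ⟨rfl, rfl⟩, h⟩)
      · exact .inr h
      · exact .inl ⟨by simpa using h, rfl⟩

theorem primrec_orderedPairs : Primrec (orderedPairs : List γ → List (γ × γ)) := by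
  refine (Primrec.list_rec (f := id) (g := fun _ => ([] : List (γ × γ)))
    (h := fun _ p => p.2.1.map (fun b => (p.1, b)) ++ p.2.2) Primrec.id (Primrec.const [])
    ?_).of_eq fun l => ?_
  · refine Primrec.list_append.comp (Primrec.list_map ?_ (Primrec₂.mk ?_)) ?_
    · exact Primrec.fst.comp (Primrec.snd.comp Primrec.snd)
    · exact (Primrec.fst.comp (Primrec.snd.comp Primrec.fst)).pair Primrec.snd
    · exact Primrec.snd.comp (Primrec.snd.comp Primrec.snd)
  · induction l with
    | nil => rfl
    | cons a l ih => exact congrArg (_ ++ ·) ih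

end Primrec

/-! ### Decidability of the definite relationships -/

theorem primrec_free : Primrec Var.free :=
  (Primrec.of_equiv_symm (e := Var.equiv)).comp (Primrec.option_some.comp Primrec.sumInl)

theorem primrec_bound : Primrec Var.bound :=
  (Primrec.of_equiv_symm (e := Var.equiv)).comp (Primrec.option_some.comp Primrec.sumInr)

theorem primrec_pointsTo_equiv : Primrec PointsTo.equiv := Primrec.of_equiv

theorem primrec_pointsTo_src : Primrec PointsTo.src := Primrec.fst.comp primrec_pointsTo_equiv

theorem primrec_pointsTo_tgt : Primrec PointsTo.tgt := Primrec.snd.comp primrec_pointsTo_equiv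

theorem primrec_call_equiv : Primrec Call.equiv := Primrec.of_equiv

theorem primrec_call_args : Primrec Call.args := Primrec.snd.comp primrec_call_equiv

theorem primrec_call_arity : Primrec fun c : Call => c.pred.arity :=
  Primrec.snd.comp (Primrec.fst.comp primrec_call_equiv)

theorem primrec_pureFormula_equiv : Primrec PureFormula.equiv := Primrec.of_equiv

section Raw

theorem primrec_raw_numFree : Primrec fun r : RawHeap => r.1 := Primrec.fst

theorem primrec_raw_numBound : Primrec fun r : RawHeap => r.2.1 := Primrec.fst.comp Primrec.snd

theorem primrec_raw_spatial : Primrec fun r : RawHeap => r.2.2.1 :=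
  Primrec.fst.comp (Primrec.snd.comp Primrec.snd)

theorem primrec_raw_calls : Primrec fun r : RawHeap => r.2.2.2.1 :=
  Primrec.fst.comp (Primrec.snd.comp (Primrec.snd.comp Primrec.snd))

theorem primrec_raw_pure : Primrec fun r : RawHeap => r.2.2.2.2 :=
  Primrec.snd.comp (Primrec.snd.comp (Primrec.snd.comp Primrec.snd))

theorem primrec_raw_sources : Primrec fun r : RawHeap => r.2.2.1.map PointsTo.src :=
  Primrec.list_map primrec_raw_spatial (Primrec₂.mk (primrec_pointsTo_src.comp Primrec.snd))

/-- The equations of a written symbolic heap, in both directions. -/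
def rawEqualities (r : RawHeap) : List (Var × Var) :=
  r.2.2.2.2.flatMap fun π => Sum.casesOn (PureFormula.equiv π) (fun p => [p, p.swap]) fun _ => []

theorem primrec_rawEqualities : Primrec rawEqualities := by
  refine Primrec.list_flatMap primrec_raw_pure (Primrec₂.mk ?_)
  refine Primrec.sumCasesOn (primrec_pureFormula_equiv.comp Primrec.snd) (Primrec₂.mk ?_)
    (Primrec₂.mk (Primrec.const []))
  refine Primrec.list_cons.comp Primrec.snd (Primrec.list_cons.comp ?_ (Primrec.const []))
  exact (Primrec.snd.comp Primrec.snd).pair (Primrec.fst.comp Primrec.snd)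

theorem mem_rawEqualities {r : RawHeap} {a b : Var} : (a, b) ∈ rawEqualities r ↔
    (SymbolicHeap.ofRaw r).constraints.eq a b ∨ (SymbolicHeap.ofRaw r).constraints.eq b a := by
  simp only [rawEqualities, List.mem_flatMap, SymbolicHeap.constraints, SymbolicHeap.ofRaw,
    List.mem_toFinset]
  constructor
  · rintro ⟨⟨c, d⟩ | ⟨c, d⟩, h, hm⟩
    · simp only [PureFormula.equiv, Equiv.coe_fn_mk, Prod.swap, List.mem_cons, Prod.mk.injEq,
        List.not_mem_nil, or_false] at hm
      rcases hm with ⟨rfl, rfl⟩ | ⟨rfl, rfl⟩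
      · exact .inl h
      · exact .inr h
    · simp [PureFormula.equiv] at hm
  · rintro (h | h)
    · exact ⟨_, h, by simp [PureFormula.equiv]⟩
    · exact ⟨_, h, by simp [PureFormula.equiv]⟩

/-- The disequalities between variables that are imposed by a written symbolic heap, up to
symmetry. -/
def rawDisequalities (r : RawHeap) : List (Var × Var) :=
  (r.2.2.2.2.flatMap fun π => Sum.casesOn (PureFormula.equiv π) (fun _ => []) fun p => [p]) ++
    ((r.2.2.1.map PointsTo.src).map (fun a => (Var.null, a)) ++
      orderedPairs (r.2.2.1.map PointsTo.src))

theorem primrec_rawDisequalities : Primrec rawDisequalities := by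
  refine Primrec.list_append.comp (Primrec.list_flatMap primrec_raw_pure (Primrec₂.mk ?_))
    (Primrec.list_append.comp (Primrec.list_map primrec_raw_sources (Primrec₂.mk ?_))
      (primrec_orderedPairs.comp primrec_raw_sources))
  · exact Primrec.sumCasesOn (primrec_pureFormula_equiv.comp Primrec.snd)
      (Primrec₂.mk (Primrec.const []))
      (Primrec₂.mk (Primrec.list_cons.comp Primrec.snd (Primrec.const [])))
  · exact (Primrec.const Var.null).pair Primrec.snd

theorem mem_rawDisequalities {r : RawHeap} {a b : Var} :
    (SymbolicHeap.ofRaw r).constraints.ne a b ↔ (a, b) ∈ rawDisequalities r ∨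
      [b, a] <+ r.2.2.1.map PointsTo.src := by
  have h : (∃ π ∈ r.2.2.2.2, (a, b) ∈ (Sum.casesOn (PureFormula.equiv π) (fun _ => [])
      fun p => [p] : List (Var × Var))) ↔ .ne a b ∈ r.2.2.2.2 := by
    constructor
    · rintro ⟨⟨c, d⟩ | ⟨c, d⟩, h, hm⟩
      · simp [PureFormula.equiv] at hm
      · simp only [PureFormula.equiv, Equiv.coe_fn_mk, List.mem_cons, Prod.mk.injEq,
          List.not_mem_nil, or_false] at hm
        obtain ⟨rfl, rfl⟩ := hm
        exact h
    · exact fun h => ⟨_, h, by simp [PureFormula.equiv]⟩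
  have h' : (a, b) ∈ (r.2.2.1.map PointsTo.src).map (fun a => (Var.null, a)) ↔
      a = .null ∧ b ∈ r.2.2.1.map PointsTo.src := by
    rw [List.mem_map]
    simp only [Prod.mk.injEq, exists_eq_right_right]
    exact and_comm.trans (and_congr_left' eq_comm)
  simp only [rawDisequalities, List.mem_append, List.mem_flatMap, h, h', mem_orderedPairs,
    SymbolicHeap.constraints, SymbolicHeap.ofRaw, List.mem_toFinset, or_assoc]

/-- The points-to edges of a written symbolic heap. -/
def rawEdges (r : RawHeap) : List (Var × Var) :=
  r.2.2.1.flatMap fun p => p.tgt.map fun y => (p.src, y)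

theorem primrec_rawEdges : Primrec rawEdges := by
  refine Primrec.list_flatMap primrec_raw_spatial (Primrec₂.mk ?_)
  exact Primrec.list_map (primrec_pointsTo_tgt.comp Primrec.snd) (Primrec₂.mk
    ((primrec_pointsTo_src.comp (Primrec.snd.comp Primrec.fst)).pair Primrec.snd))

theorem mem_rawEdges {r : RawHeap} {a b : Var} :
    (a, b) ∈ rawEdges r ↔ (SymbolicHeap.ofRaw r).constraints.pt a b := by
  simp only [rawEdges, List.mem_flatMap, List.mem_map, Prod.mk.injEq, SymbolicHeap.constraints,
    SymbolicHeap.ofRaw]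
  constructor
  · rintro ⟨p, hp, y, hy, rfl, rfl⟩
    exact ⟨p, hp, rfl, hy⟩
  · rintro ⟨p, hp, rfl, hy⟩
    exact ⟨p, hp, b, hy, rfl, rfl⟩

variable {β : Type*} [Primcodable β] {r : β → RawHeap} {x y : β → Var}

theorem primrecPred_equal (hr : Primrec r) (hx : Primrec x) (hy : Primrec y) :
    PrimrecPred fun a => (SymbolicHeap.ofRaw (r a)).constraints.Equal (x a) (y a) :=
  (primrecPred_reflTransGen (primrec_rawEqualities.comp hr) hx hy).of_eq fun a => by
    simp only [mem_rawEqualities, ConstraintSystem.Equal]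

theorem primrecPred_inconsistent (hr : Primrec r) :
    PrimrecPred fun a => (SymbolicHeap.ofRaw (r a)).constraints.Inconsistent := by
  refine (primrecPred_exists_mem (p := fun a (e : Var × Var) =>
    (SymbolicHeap.ofRaw (r a)).constraints.Equal e.1 e.2) (primrec_rawDisequalities.comp hr)
      (primrecPred_equal (hr.comp Primrec.fst) (Primrec.fst.comp Primrec.snd)
        (Primrec.snd.comp Primrec.snd))).of_eq fun a => ?_
  constructor
  · rintro ⟨⟨u, v⟩, h, he⟩
    exact ⟨u, v, mem_rawDisequalities.2 (.inl h), he⟩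
  · rintro ⟨u, v, h, he⟩
    rcases mem_rawDisequalities.1 h with h | h
    · exact ⟨(u, v), h, he⟩
    · exact ⟨(v, u), List.mem_append_right _ (List.mem_append_right _ (mem_orderedPairs.2 h)),
        he.symm⟩

theorem primrecPred_unequal (hr : Primrec r) (hx : Primrec x) (hy : Primrec y) :
    PrimrecPred fun a => (SymbolicHeap.ofRaw (r a)).constraints.Unequal (x a) (y a) := by
  have hE : ∀ {f g : β × Var × Var → Var}, Primrec f → Primrec g → PrimrecPred fun p =>
      (SymbolicHeap.ofRaw (r p.1)).constraints.Equal (f p) (g p) :=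
    fun hf hg => primrecPred_equal (hr.comp Primrec.fst) hf hg
  have h1 : Primrec fun p : β × Var × Var => p.2.1 := Primrec.fst.comp Primrec.snd
  have h2 : Primrec fun p : β × Var × Var => p.2.2 := Primrec.snd.comp Primrec.snd
  have hx' : Primrec fun p : β × Var × Var => x p.1 := hx.comp Primrec.fst
  have hy' : Primrec fun p : β × Var × Var => y p.1 := hy.comp Primrec.fst
  refine (primrecPred_exists_mem (p := fun a (e : Var × Var) =>
    ((SymbolicHeap.ofRaw (r a)).constraints.Equal (x a) e.1 ∧
      (SymbolicHeap.ofRaw (r a)).constraints.Equal (y a) e.2) ∨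
    ((SymbolicHeap.ofRaw (r a)).constraints.Equal (x a) e.2 ∧
      (SymbolicHeap.ofRaw (r a)).constraints.Equal (y a) e.1)) (primrec_rawDisequalities.comp hr)
      (((hE hx' h1).and (hE hy' h2)).or ((hE hx' h2).and (hE hy' h1)))).of_eq fun a => ?_
  have key : ∀ {u v : Var}, (SymbolicHeap.ofRaw (r a)).constraints.ne u v →
      (u, v) ∈ rawDisequalities (r a) ∨ (v, u) ∈ rawDisequalities (r a) := fun h =>
    (mem_rawDisequalities.1 h).imp_right fun h =>
      List.mem_append_right _ (List.mem_append_right _ (mem_orderedPairs.2 h))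
  constructor
  · rintro ⟨⟨u, v⟩, h, ⟨h1, h2⟩ | ⟨h1, h2⟩⟩
    · exact ⟨u, v, .inl (mem_rawDisequalities.2 (.inl h)), h1, h2⟩
    · exact ⟨v, u, .inr (mem_rawDisequalities.2 (.inl h)), h1, h2⟩
  · rintro ⟨u, v, h, h1, h2⟩
    rcases h.elim key fun h => (key h).symm with h | h
    · exact ⟨(u, v), h, .inl ⟨h1, h2⟩⟩
    · exact ⟨(v, u), h, .inr ⟨h1, h2⟩⟩

theorem primrecPred_alloc (hr : Primrec r) (hx : Primrec x) :
    PrimrecPred fun a => (SymbolicHeap.ofRaw (r a)).constraints.Alloc (x a) :=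
  (primrecPred_exists_mem (p := fun a (u : Var) =>
    (SymbolicHeap.ofRaw (r a)).constraints.Equal (x a) u) (primrec_raw_sources.comp hr)
      (primrecPred_equal (hr.comp Primrec.fst) (hx.comp Primrec.fst) Primrec.snd)).of_eq
        fun _ => Iff.rfl

theorem reflTransGen_append_iff_leads {r : RawHeap} {x y : Var} :
    Relation.ReflTransGen (fun a b => (a, b) ∈ rawEqualities r ++ rawEdges r) x y ↔
      (SymbolicHeap.ofRaw r).constraints.Leads x y := by
  have hE : ∀ {x y}, (SymbolicHeap.ofRaw r).constraints.Equal x y →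
      Relation.ReflTransGen (fun a b => (a, b) ∈ rawEqualities r ++ rawEdges r) x y := fun h =>
    Relation.ReflTransGen.mono
      (fun _ _ h => List.mem_append_left _ (mem_rawEqualities.2 h)) _ _ h
  constructor
  · intro h
    induction h with
    | refl => exact .inl (.refl _)
    | tail _ h ih =>
      refine ih.trans ?_
      rcases List.mem_append.1 h with h | h
      · exact .inl (.single (mem_rawEqualities.1 h))
      · exact .inr (.single ⟨_, _, mem_rawEdges.1 h, .refl _, .refl _⟩)
  · have hS : ∀ {x y}, (SymbolicHeap.ofRaw r).constraints.Step x y →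
        Relation.ReflTransGen (fun a b => (a, b) ∈ rawEqualities r ++ rawEdges r) x y := by
      rintro x y ⟨u, v, h, hx, hy⟩
      exact ((hE hx).tail (List.mem_append_right _ (mem_rawEdges.2 h))).trans (hE hy.symm)
    rintro (h | h)
    · exact hE h
    · induction h with
      | single h => exact hS h
      | tail _ h ih => exact ih.trans (hS h)

/-- Reachability by a nonempty path is reachability through some points-to edge. -/
theorem primrecPred_reach (hr : Primrec r) (hx : Primrec x) (hy : Primrec y) :
    PrimrecPred fun a => (SymbolicHeap.ofRaw (r a)).constraints.Reach (x a) (y a) := by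
  have hL : ∀ {f g : β × Var × Var → Var}, Primrec f → Primrec g → PrimrecPred fun p =>
      (SymbolicHeap.ofRaw (r p.1)).constraints.Leads (f p) (g p) := fun hf hg =>
    (primrecPred_reflTransGen ((Primrec.list_append.comp primrec_rawEqualities
      primrec_rawEdges).comp (hr.comp Primrec.fst)) hf hg).of_eq
        fun _ => reflTransGen_append_iff_leads
  refine (primrecPred_exists_mem (p := fun a (e : Var × Var) =>
    (SymbolicHeap.ofRaw (r a)).constraints.Leads (x a) e.1 ∧
      (SymbolicHeap.ofRaw (r a)).constraints.Leads e.2 (y a)) (primrec_rawEdges.comp hr)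
      ((hL (hx.comp Primrec.fst) (Primrec.fst.comp Primrec.snd)).and
        (hL (Primrec.snd.comp Primrec.snd) (hy.comp Primrec.fst)))).of_eq fun a => ?_
  constructor
  · rintro ⟨⟨u, v⟩, h, h1, h2⟩
    have huv : (SymbolicHeap.ofRaw (r a)).constraints.Reach u v :=
      .single ⟨u, v, mem_rawEdges.1 h, .refl u, .refl v⟩
    rcases h2 with h2 | h2
    · exact h1.reach (huv.congr_right h2)
    · exact h1.reach (Relation.TransGen.trans huv h2)
  · intro h
    have key : ∀ z, (SymbolicHeap.ofRaw (r a)).constraints.Step (x a) z →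
        (SymbolicHeap.ofRaw (r a)).constraints.Leads z (y a) → ∃ e ∈ rawEdges (r a),
        (SymbolicHeap.ofRaw (r a)).constraints.Leads (x a) e.1 ∧
          (SymbolicHeap.ofRaw (r a)).constraints.Leads e.2 (y a) := by
      rintro z ⟨u, v, h, h1, h2⟩ hz
      exact ⟨(u, v), mem_rawEdges.2 h, .inl h1, .trans (.inl h2.symm) hz⟩
    rcases Relation.TransGen.head'_iff.1 h with ⟨z, h1, h2⟩
    rcases Relation.reflTransGen_iff_eq_or_transGen.1 h2 with h2 | h2
    · exact key z h1 (.inl (h2 ▸ .refl _))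
    · exact key z h1 (.inr h2)

theorem primrecPred_inScope {n k : β → ℕ} (hn : Primrec n) (hk : Primrec k) (hx : Primrec x) :
    PrimrecPred fun a => (x a).InScope (n a) (k a) := by
  refine ((Primrec.eq.comp hx (Primrec.const Var.null)).or
    ((primrecPred_exists_mem (p := fun a i => x a = Var.free i) (Primrec.list_range.comp hn)
      (Primrec.eq.comp (hx.comp Primrec.fst) (primrec_free.comp Primrec.snd))).or
    (primrecPred_exists_mem (p := fun a i => x a = Var.bound i) (Primrec.list_range.comp hk)
      (Primrec.eq.comp (hx.comp Primrec.fst) (primrec_bound.comp Primrec.snd))))).of_eq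
        fun a => ?_
  rcases x a with _ | i | j <;> simp [Var.InScope]

theorem primrecPred_raw_inScope (hr : Primrec r) (hx : Primrec x) :
    PrimrecPred fun a => (x a).InScope (r a).1 (r a).2.1 :=
  primrecPred_inScope (primrec_raw_numFree.comp hr) (primrec_raw_numBound.comp hr) hx

theorem primrecPred_raw_forall_inScope {l : β → List Var} (hr : Primrec r) (hl : Primrec l) :
    PrimrecPred fun a => ∀ y ∈ l a, y.InScope (r a).1 (r a).2.1 :=
  primrecPred_forall_mem (p := fun a (y : Var) => y.InScope (r a).1 (r a).2.1) hl
    (primrecPred_raw_inScope (hr.comp Primrec.fst) Primrec.snd)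

theorem primrecPred_raw_pure_inScope : PrimrecPred fun r : RawHeap =>
    ∀ π ∈ r.2.2.2.2, π.InScope r.1 r.2.1 := by
  have hsides : Primrec fun π : PureFormula =>
      (Sum.casesOn (PureFormula.equiv π) id id : Var × Var) :=
    Primrec.sumCasesOn primrec_pureFormula_equiv (Primrec₂.mk Primrec.snd)
      (Primrec₂.mk Primrec.snd)
  have h : PrimrecPred fun p : RawHeap × PureFormula =>
      (Sum.casesOn (PureFormula.equiv p.2) id id : Var × Var).1.InScope p.1.1 p.1.2.1 ∧
      (Sum.casesOn (PureFormula.equiv p.2) id id : Var × Var).2.InScope p.1.1 p.1.2.1 :=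
    (primrecPred_raw_inScope Primrec.fst (Primrec.fst.comp (hsides.comp Primrec.snd))).and
      (primrecPred_raw_inScope Primrec.fst (Primrec.snd.comp (hsides.comp Primrec.snd)))
  have h' : PrimrecPred fun p : RawHeap × PureFormula => p.2.InScope p.1.1 p.1.2.1 :=
    h.of_eq fun p => by rcases p with ⟨r, ⟨a, b⟩ | ⟨a, b⟩⟩ <;> rfl
  exact primrecPred_forall_mem (p := fun (r : RawHeap) (π : PureFormula) => π.InScope r.1 r.2.1)
    primrec_raw_pure h'

theorem primrecPred_wellFormed :
    PrimrecPred fun r : RawHeap => (SymbolicHeap.ofRaw r).WellFormed := by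
  have h1 : PrimrecPred fun r : RawHeap => ∀ a ∈ r.2.2.1, a.src.InScope r.1 r.2.1 :=
    primrecPred_forall_mem (p := fun (r : RawHeap) (a : PointsTo) => a.src.InScope r.1 r.2.1)
      primrec_raw_spatial
      (primrecPred_raw_inScope Primrec.fst (primrec_pointsTo_src.comp Primrec.snd))
  have h2 : PrimrecPred fun r : RawHeap =>
      ∀ a ∈ r.2.2.1, ∀ y ∈ a.tgt, y.InScope r.1 r.2.1 :=
    primrecPred_forall_mem
      (p := fun (r : RawHeap) (a : PointsTo) => ∀ y ∈ a.tgt, y.InScope r.1 r.2.1)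
      primrec_raw_spatial
      (primrecPred_raw_forall_inScope Primrec.fst (primrec_pointsTo_tgt.comp Primrec.snd))
  have h3 : PrimrecPred fun r : RawHeap => ∀ c ∈ r.2.2.2.1, c.args.length = c.pred.arity :=
    primrecPred_forall_mem (p := fun (_ : RawHeap) (c : Call) => c.args.length = c.pred.arity)
      primrec_raw_calls
      (Primrec.eq.comp (Primrec.list_length.comp (primrec_call_args.comp Primrec.snd))
        (primrec_call_arity.comp Primrec.snd))
  have h4 : PrimrecPred fun r : RawHeap =>
      ∀ c ∈ r.2.2.2.1, ∀ y ∈ c.args, y.InScope r.1 r.2.1 :=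
    primrecPred_forall_mem
      (p := fun (r : RawHeap) (c : Call) => ∀ y ∈ c.args, y.InScope r.1 r.2.1)
      primrec_raw_calls
      (primrecPred_raw_forall_inScope Primrec.fst (primrec_call_args.comp Primrec.snd))
  refine (h1.and (h2.and (h3.and (h4.and primrecPred_raw_pure_inScope)))).of_eq fun r => ?_
  exact ⟨fun ⟨h1, h2, h3, h4, h5⟩ => ⟨h1, h2, h3, h4, fun π hπ => h5 π (List.mem_toFinset.1 hπ)⟩,
    fun h => ⟨h.1, h.2, h.3, h.4, fun π hπ => h.5 π (List.mem_toFinset.2 hπ)⟩⟩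

/-- It is decidable whether a written symbolic heap has a given state. -/
theorem primrecPred_stateOf_eq {Val : Type*} (M : MemoryModel Val) {α : ℕ} {ι : Type*} [Finite ι]
    [Primcodable ι] (e : ι → State α) :
    PrimrecPred fun p : RawHeap × ι =>
      (SymbolicHeap.ofRaw p.1).WellFormed ∧ stateOf M α (SymbolicHeap.ofRaw p.1) = e p.2 := by
  have hle : ∀ i : ℕ, PrimrecPred fun p : RawHeap × ι => i ≤ p.1.1 := fun i =>
    Primrec.nat_le.comp (Primrec.const i) (primrec_raw_numFree.comp Primrec.fst)
  have hc := primrecPred_inconsistent (β := RawHeap × ι) Primrec.fst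
  have hfin : ∀ P : ι → Prop, PrimrecPred fun p : RawHeap × ι => P p.2 :=
    fun P => (primrecPred_of_finite P).comp Primrec.snd
  have hA := primrecPred_forall_finite fun i : Fin (α + 1) =>
    primrecPred_iff ((hle i).and (hc.or (primrecPred_alloc Primrec.fst (Primrec.const (param i)))))
      (hfin fun q => i ∈ (e q).1)
  have hE := primrecPred_forall_finite fun i : Fin (α + 1) × Fin (α + 1) =>
    primrecPred_iff ((hle i.1).and ((hle i.2).and (hc.or (primrecPred_equal Primrec.fst
      (Primrec.const (param i.1)) (Primrec.const (param i.2))))))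
      (hfin fun q => i ∈ (e q).2.1)
  have hN := primrecPred_forall_finite fun i : Fin (α + 1) × Fin (α + 1) =>
    primrecPred_iff ((hle i.1).and ((hle i.2).and (hc.or (primrecPred_unequal Primrec.fst
      (Primrec.const (param i.1)) (Primrec.const (param i.2))))))
      (hfin fun q => i ∈ (e q).2.2.1)
  have hR := primrecPred_forall_finite fun i : Fin (α + 1) × Fin (α + 1) =>
    primrecPred_iff ((hle i.1).and ((hle i.2).and (hc.or (primrecPred_reach Primrec.fst
      (Primrec.const (param i.1)) (Primrec.const (param i.2))))))
      (hfin fun q => i ∈ (e q).2.2.2)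
  refine ((primrecPred_wellFormed.comp Primrec.fst).and
    (hA.and (hE.and (hN.and hR)))).of_eq fun ⟨r, q⟩ => and_congr_right fun hwf => ?_
  have hp : ∀ {i}, i ≤ r.1 → param i ∈ (SymbolicHeap.ofRaw r).vars := fun hi =>
    scope_mono _ (Nat.zero_le _) (mem_scope_zero.2 ⟨_, hi, rfl⟩)
  simp only [stateOf, Prod.ext_iff (y := e q), Prod.ext_iff (y := (e q).2),
    Prod.ext_iff (y := (e q).2.2)]
  refine and_congr ?_ (and_congr ?_ (and_congr ?_ ?_)) <;> rw [Set.ext_iff] <;>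
    refine forall_congr' fun i => iff_congr ?_ Iff.rfl
  · exact and_congr_right fun _ => (defAlloc_iff M _ _).symm
  · exact and_congr_right fun _ => and_congr_right fun _ => (defEq_iff M _ _ _).symm
  · exact and_congr_right fun _ => and_congr_right fun _ => (defNe_iff M _ _ _).symm
  · exact and_congr_right fun hi => and_congr_right fun hj =>
      (defReach_iff M hwf (hp hi) (hp hj)).symm

/-- `SymbolicHeap.plug` on written symbolic heaps. -/
def rawPlug (r : RawHeap) (args : List Var) (t : RawHeap) : RawHeap :=
  (r.1, r.2.1 + t.2.1, r.2.2.1 ++ t.2.2.1.map (PointsTo.inst args r.2.1),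
    r.2.2.2.1 ++ t.2.2.2.1.map (Call.inst args r.2.1),
    r.2.2.2.2 ++ t.2.2.2.2.map (PureFormula.inst args r.2.1))

theorem ofRaw_rawPlug (r : RawHeap) (args : List Var) (t : RawHeap) :
    SymbolicHeap.ofRaw (rawPlug r args t) =
      (SymbolicHeap.ofRaw r).plug args (SymbolicHeap.ofRaw t) := by
  simp only [SymbolicHeap.ofRaw, rawPlug, SymbolicHeap.plug, SymbolicHeap.mk.injEq, true_and,
    List.toFinset_append]
  ext π
  simp

theorem primrec_var_inst {args : β → List Var} {k : β → ℕ} (ha : Primrec args) (hk : Primrec k)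
    (hx : Primrec x) : Primrec fun a => (x a).inst (args a) (k a) := by
  refine (Primrec.option_casesOn (o := fun a => Var.equiv (x a)) (f := fun _ => Var.null)
    (g := fun a s => Sum.casesOn s (fun i => (args a).getD i .null) fun j => .bound (k a + j))
    (Primrec.of_equiv.comp hx) (Primrec.const _) (Primrec₂.mk ?_)).of_eq fun a => ?_
  · refine Primrec.sumCasesOn Primrec.snd (Primrec₂.mk ?_) (Primrec₂.mk ?_)
    · exact (Primrec.list_getD Var.null).comp (ha.comp (Primrec.fst.comp Primrec.fst)) Primrec.snd
    · exact primrec_bound.comp (Primrec.nat_add.comp (hk.comp (Primrec.fst.comp Primrec.fst))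
        Primrec.snd)
  · rcases x a with _ | i | j <;> rfl

theorem primrec_list_inst {args : β → List Var} {k : β → ℕ} {l : β → List Var}
    (ha : Primrec args) (hk : Primrec k) (hl : Primrec l) :
    Primrec fun a => (l a).map (Var.inst (args a) (k a)) :=
  Primrec.list_map hl (Primrec₂.mk (primrec_var_inst (ha.comp Primrec.fst) (hk.comp Primrec.fst)
    Primrec.snd))

theorem primrec_rawPlug {args : β → List Var} {t : β → RawHeap} (hr : Primrec r)
    (ha : Primrec args) (ht : Primrec t) : Primrec fun a => rawPlug (r a) (args a) (t a) := by
  have hk : Primrec fun a => (r a).2.1 := primrec_raw_numBound.comp hr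
  refine (primrec_raw_numFree.comp hr).pair ((Primrec.nat_add.comp hk
    (primrec_raw_numBound.comp ht)).pair ((Primrec.list_append.comp (primrec_raw_spatial.comp hr)
      (Primrec.list_map (primrec_raw_spatial.comp ht) (Primrec₂.mk ?_))).pair
    ((Primrec.list_append.comp (primrec_raw_calls.comp hr)
      (Primrec.list_map (primrec_raw_calls.comp ht) (Primrec₂.mk ?_))).pair
    (Primrec.list_append.comp (primrec_raw_pure.comp hr)
      (Primrec.list_map (primrec_raw_pure.comp ht) (Primrec₂.mk ?_))))))
  · exact (Primrec.of_equiv_symm (e := PointsTo.equiv)).comp ((primrec_var_inst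
      (ha.comp Primrec.fst) (hk.comp Primrec.fst) (primrec_pointsTo_src.comp Primrec.snd)).pair
      (primrec_list_inst (ha.comp Primrec.fst) (hk.comp Primrec.fst)
        (primrec_pointsTo_tgt.comp Primrec.snd)))
  · exact (Primrec.of_equiv_symm (e := Call.equiv)).comp
      ((Primrec.fst.comp (primrec_call_equiv.comp Primrec.snd)).pair
      (primrec_list_inst (ha.comp Primrec.fst) (hk.comp Primrec.fst)
        (primrec_call_args.comp Primrec.snd)))
  · have hpair : Primrec fun p : (β × PureFormula) × Var × Var =>
        (p.2.1.inst (args p.1.1) (r p.1.1).2.1, p.2.2.inst (args p.1.1) (r p.1.1).2.1) :=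
      (primrec_var_inst (ha.comp (Primrec.fst.comp Primrec.fst))
        (hk.comp (Primrec.fst.comp Primrec.fst)) (Primrec.fst.comp Primrec.snd)).pair
      (primrec_var_inst (ha.comp (Primrec.fst.comp Primrec.fst))
        (hk.comp (Primrec.fst.comp Primrec.fst)) (Primrec.snd.comp Primrec.snd))
    have hl : Primrec₂ fun (p : β × PureFormula) (q : Var × Var) =>
        (Sum.inl (q.1.inst (args p.1) (r p.1).2.1, q.2.inst (args p.1) (r p.1).2.1) :
          (Var × Var) ⊕ (Var × Var)) := Primrec₂.mk (Primrec.sumInl.comp hpair)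
    have hr : Primrec₂ fun (p : β × PureFormula) (q : Var × Var) =>
        (Sum.inr (q.1.inst (args p.1) (r p.1).2.1, q.2.inst (args p.1) (r p.1).2.1) :
          (Var × Var) ⊕ (Var × Var)) := Primrec₂.mk (Primrec.sumInr.comp hpair)
    refine ((Primrec.of_equiv_symm (e := PureFormula.equiv)).comp (Primrec.sumCasesOn
      (primrec_pureFormula_equiv.comp Primrec.snd) hl hr)).of_eq fun p => ?_
    rcases p with ⟨a, ⟨b, c⟩ | ⟨b, c⟩⟩ <;> rfl

/-- `SymbolicHeap.replace` on written symbolic heaps. The list of the heaps that remain to be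
plugged in is part of the state of the iteration. -/
def rawReplace (r : RawHeap) (ts : List RawHeap) : RawHeap :=
  (r.2.2.2.1.foldl (fun p c => (p.2.head?.elim p.1 (rawPlug p.1 c.args), p.2.tail))
    (((r.1, r.2.1, r.2.2.1, [], r.2.2.2.2), ts) : RawHeap × List RawHeap)).1

theorem ofRaw_rawReplace (r : RawHeap) (ts : List RawHeap) :
    SymbolicHeap.ofRaw (rawReplace r ts) =
      (SymbolicHeap.ofRaw r).replace (ts.map SymbolicHeap.ofRaw) := by
  have key : ∀ (cs : List Call) (ts : List RawHeap) (s : RawHeap),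
      SymbolicHeap.ofRaw (cs.foldl
        (fun p c => (p.2.head?.elim p.1 (rawPlug p.1 c.args), p.2.tail)) (s, ts)).1 =
      (cs.zip (ts.map SymbolicHeap.ofRaw)).foldl (fun ψ c => ψ.plug c.1.args c.2)
        (SymbolicHeap.ofRaw s) := by
    intro cs
    induction cs with
    | nil => intro ts s; rfl
    | cons c cs ih =>
      intro ts s
      rcases ts with _ | ⟨t, ts⟩
      · simpa using ih [] s
      · simpa [ofRaw_rawPlug] using ih ts (rawPlug s c.args t)
  exact key _ _ _

theorem primrec_rawReplace : Primrec₂ rawReplace := by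
  refine Primrec₂.mk (Primrec.fst.comp (Primrec.list_foldl
    (h := fun _ (p : (RawHeap × List RawHeap) × Call) =>
      (p.1.2.head?.elim p.1.1 (rawPlug p.1.1 p.2.args), p.1.2.tail))
    (primrec_raw_calls.comp Primrec.fst) ?_ (Primrec₂.mk ?_)))
  · have h1 : Primrec fun r : RawHeap => (([], r.2.2.2.2) : List Call × List PureFormula) :=
      Primrec.pair (Primrec.const []) primrec_raw_pure
    have h0 : Primrec fun r : RawHeap => ((r.1, r.2.1, r.2.2.1, [], r.2.2.2.2) : RawHeap) :=
      primrec_raw_numFree.pair (primrec_raw_numBound.pair (primrec_raw_spatial.pair h1))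
    exact (h0.comp Primrec.fst).pair Primrec.snd
  · have h1 : Primrec fun p : (RawHeap × List RawHeap) × (RawHeap × List RawHeap) × Call =>
        p.2.1.1 := Primrec.fst.comp (Primrec.fst.comp Primrec.snd)
    have h2 : Primrec fun p : (RawHeap × List RawHeap) × (RawHeap × List RawHeap) × Call =>
        p.2.1.2 := Primrec.snd.comp (Primrec.fst.comp Primrec.snd)
    have h3 : Primrec fun p : (RawHeap × List RawHeap) × (RawHeap × List RawHeap) × Call =>
        p.2.2.args := primrec_call_args.comp (Primrec.snd.comp Primrec.snd)
    have h4 : Primrec₂ fun (p : (RawHeap × List RawHeap) × (RawHeap × List RawHeap) × Call)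
        (t : RawHeap) => rawPlug p.2.1.1 p.2.2.args t :=
      Primrec₂.mk (primrec_rawPlug (h1.comp Primrec.fst) (h3.comp Primrec.fst) Primrec.snd)
    have h5 : Primrec fun p : (RawHeap × List RawHeap) × (RawHeap × List RawHeap) × Call =>
        p.2.1.2.head?.elim p.2.1.1 (rawPlug p.2.1.1 p.2.2.args) :=
      (Primrec.option_casesOn (Primrec.list_head?.comp h2) h1 h4).of_eq fun p => by
        rcases p.2.1.2.head? with _ | t <;> rfl
    exact h5.pair (Primrec.list_tail.comp h2)

theorem exists_ofRaw (τ : SymbolicHeap) : ∃ r, SymbolicHeap.ofRaw r = τ :=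
  ⟨(τ.numFree, τ.numBound, τ.spatial, τ.calls, τ.pure.toList), by
    simp [SymbolicHeap.ofRaw]⟩

end Raw

/-! ### The automaton -/

theorem replace_nil {φ : SymbolicHeap} (hφ : φ.Reduced) : φ.replace [] = φ := by
  obtain ⟨n, k, A, C, E⟩ := φ
  obtain rfl : C = [] := hφ
  rfl

section Automaton

variable {Val : Type*} (M : MemoryModel Val) (α : ℕ)

/-- A bijection between the states of reduced symbolic heaps and an initial segment of `ℕ`. -/
noncomputable def stateEquiv : Fin (Nat.card (State α)) ≃ State α :=
  (Finite.equivFin (State α)).symm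

theorem exists_representative (q : Fin (Nat.card (State α))) :
    ∃ r : RawHeap, SymbolicHeap.ofRaw r ∈ RSL α ∧
      ∀ τ ∈ RSL α, stateOf M α τ = stateEquiv α q →
        stateOf M α (SymbolicHeap.ofRaw r) = stateEquiv α q := by
  by_cases h : ∃ τ ∈ RSL α, stateOf M α τ = stateEquiv α q
  · obtain ⟨τ, hτ, hq⟩ := h
    obtain ⟨r, rfl⟩ := exists_ofRaw τ
    exact ⟨r, hτ, fun _ _ _ => hq⟩
  · refine ⟨(0, 0, [], [], []), ⟨⟨⟨?_, ?_, ?_, ?_, ?_⟩, Nat.zero_le α⟩, rfl⟩,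
      fun τ hτ hq => absurd ⟨τ, hτ, hq⟩ h⟩ <;> simp [SymbolicHeap.ofRaw]

/-- A written reduced symbolic heap with the given state. For a state that no heap has, it is
some arbitrary reduced symbolic heap. -/
noncomputable def representative (q : Fin (Nat.card (State α))) : RawHeap :=
  (exists_representative M α q).choose

/-- The reduced symbolic heap that is described by `representative M α q`. -/
noncomputable def repHeap (q : Fin (Nat.card (State α))) : SymbolicHeap :=
  SymbolicHeap.ofRaw (representative M α q)

theorem repHeap_mem (q : Fin (Nat.card (State α))) : repHeap M α q ∈ RSL α :=
  (exists_representative M α q).choose_spec.1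

theorem stateOf_repHeap {q : Fin (Nat.card (State α))} {τ : SymbolicHeap} (hτ : τ ∈ RSL α)
    (h : stateOf M α τ = stateEquiv α q) : stateOf M α (repHeap M α q) = stateEquiv α q :=
  (exists_representative M α q).choose_spec.2 τ hτ h

theorem map_repHeap_mem {q : List (Fin (Nat.card (State α)))} :
    ∀ τ ∈ q.map (repHeap M α), τ.WellFormed ∧ τ.Reduced := by
  intro τ hτ
  obtain ⟨i, -, rfl⟩ := List.mem_map.1 hτ
  exact ⟨(repHeap_mem M α i).1.1, (repHeap_mem M α i).2⟩

/-- The automaton that computes states. To find the state of `φ` when the states `q` of the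
heaps that replace its calls are given, these heaps are exchanged for representatives of `q`. -/
noncomputable def stateAutomaton (F : Set (State α)) : HeapAutomaton (SL α) where
  numStates := Nat.card (State α)
  Δ q φ p := φ ∈ SL α ∧ q.length = φ.calls.length ∧
    stateOf M α (φ.replace (q.map (repHeap M α))) = stateEquiv α p
  F := stateEquiv α ⁻¹' F
  mem_of_trans _ _ _ h := h.1
  length_of_trans _ _ _ h := h.2.1
  decidable_trans := by
    have hφ : Primrec fun x : List (Fin (Nat.card (State α))) × RawHeap ×
        Fin (Nat.card (State α)) => x.2.1 := Primrec.fst.comp Primrec.snd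
    have hrep : Primrec fun x : List (Fin (Nat.card (State α))) × RawHeap ×
        Fin (Nat.card (State α)) => rawReplace x.2.1 (x.1.map (representative M α)) :=
      primrec_rawReplace.comp hφ (Primrec.list_map Primrec.fst
        (Primrec₂.mk ((Primrec.dom_finite (representative M α)).comp Primrec.snd)))
    have h1 := primrecPred_wellFormed.comp hφ
    have h2 : PrimrecPred fun x : List (Fin (Nat.card (State α))) × RawHeap ×
        Fin (Nat.card (State α)) => x.2.1.1 ≤ α :=
      Primrec.nat_le.comp (primrec_raw_numFree.comp hφ) (Primrec.const α)
    have h3 : PrimrecPred fun x : List (Fin (Nat.card (State α))) × RawHeap ×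
        Fin (Nat.card (State α)) => x.1.length = x.2.1.2.2.2.1.length :=
      Primrec.eq.comp (Primrec.list_length.comp Primrec.fst)
        (Primrec.list_length.comp (primrec_raw_calls.comp hφ))
    have h4 := (primrecPred_stateOf_eq M (stateEquiv α)).comp
      (hrep.pair (Primrec.snd.comp Primrec.snd))
    refine ((h1.and h2).and (h3.and h4)).computablePred.of_eq fun x => ?_
    refine and_congr_right fun hSL => and_congr_right fun _ => ?_
    have hmap : x.1.map (repHeap M α) = (x.1.map (representative M α)).map SymbolicHeap.ofRaw := by
      rw [List.map_map]; rfl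
    simp only [ofRaw_rawReplace, ← hmap]
    exact and_iff_right (replace_mem_RSL hSL (map_repHeap_mem M α)).1.1

variable {α} (F : Set (State α))

theorem stateAutomaton_nil {τ : SymbolicHeap} (hτ : τ ∈ RSL α)
    (p : Fin (Nat.card (State α))) :
    (stateAutomaton M α F).Δ [] τ p ↔ stateOf M α τ = stateEquiv α p := by
  have hcalls : τ.calls = [] := hτ.2
  show _ ∧ _ ∧ stateOf M α (τ.replace []) = _ ↔ _
  rw [replace_nil hτ.2]
  exact ⟨fun h => h.2.2, fun h => ⟨hτ.1, by rw [hcalls]; rfl, h⟩⟩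

theorem stateAutomaton_compositional : (stateAutomaton M α F).Compositional := by
  intro p φ τs hφ hτs hcalls
  have hrepl := replace_mem_RSL hφ fun τ hτ => ⟨(hτs τ hτ).1.1, (hτs τ hτ).2⟩
  refine Iff.trans ?_ (stateAutomaton_nil M F hrepl p).symm
  have hand : ∀ {r : SymbolicHeap → Fin (Nat.card (State α)) → Prop} {q}, List.Forall₂ r τs q →
      List.Forall₂ (fun τ qi => τ ∈ RSL α ∧ r τ qi) τs q :=
    fun h => (List.forall₂_and_left _ _).2 ⟨fun τ hτ => hτs τ hτ, h⟩
  -- If the states of the heaps `τs` are `q`, the representatives of `q` are a substitute for `τs`.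
  have key : ∀ q : List (Fin (Nat.card (State α))),
      List.Forall₂ (fun τ qi => stateOf M α τ = stateEquiv α qi) τs q →
      stateOf M α (φ.replace τs) = stateOf M α (φ.replace (q.map (repHeap M α))) := by
    intro q hq
    refine stateOf_replace_congr M hφ (List.forall₂_map_right_iff.2 ?_)
    exact (hand hq).imp fun τ qi ⟨h1, h2⟩ =>
      ⟨h1, repHeap_mem M α qi, h2.trans (stateOf_repHeap M α h1 h2).symm⟩
  constructor
  · rintro ⟨q, hΔ, hq⟩
    refine (key q ?_).trans hΔ.2.2
    exact (hand hq).imp fun τ qi ⟨h1, h2⟩ => (stateAutomaton_nil M F h1 qi).1 h2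
  · intro hp
    let q := τs.map fun τ => (stateEquiv α).symm (stateOf M α τ)
    have hq : List.Forall₂ (fun τ qi => stateOf M α τ = stateEquiv α qi) τs q :=
      List.forall₂_map_right_iff.2 (List.forall₂_same.2 fun τ _ => by simp)
    refine ⟨q, ⟨hφ, ?_, (key q hq).symm.trans hp⟩, ?_⟩
    · rw [List.length_map, hcalls.length_eq]
    · exact (hand hq).imp fun τ qi ⟨h1, h2⟩ => (stateAutomaton_nil M F h1 qi).2 h2

end Automaton

end SymHeap

theorem mainTheorem6 {Val : Type*} (M : SymHeap.MemoryModel Val) (α : ℕ)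
    (R : Set (Fin (α + 1) × Fin (α + 1))) :
    ∃ A : SymHeap.HeapAutomaton (SymHeap.SL α),
      A.Compositional ∧
      A.language = SymHeap.ReachProperty M α R ∧
      ∃ (alloc : Fin A.numStates → Set (Fin (α + 1)))
        (eq ne reach : Fin A.numStates → Set (Fin (α + 1) × Fin (α + 1))),
        ∀ τ ∈ SymHeap.RSL α,
          (∃ q, A.Δ [] τ q) ∧
          ∀ q, A.Δ [] τ q →
            alloc q = SymHeap.allocSet M α τ ∧
            eq q = SymHeap.paramRel α τ (SymHeap.DefEq M τ) ∧
            ne q = SymHeap.paramRel α τ (SymHeap.DefNe M τ) ∧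
            reach q = SymHeap.paramRel α τ (SymHeap.DefReach M τ) := by
  let F : Set (SymHeap.State α) := {q | q.2.2.2 = R}
  have hnil {τ : SymHeap.SymbolicHeap} (hτ : τ ∈ SymHeap.RSL α) :=
    SymHeap.stateAutomaton_nil M F hτ
  have hex {τ : SymHeap.SymbolicHeap} (hτ : τ ∈ SymHeap.RSL α) :
      (SymHeap.stateAutomaton M α F).Δ [] τ
        ((SymHeap.stateEquiv α).symm (SymHeap.stateOf M α τ)) := by
    rw [hnil hτ, Equiv.apply_symm_apply]
  refine ⟨SymHeap.stateAutomaton M α F, SymHeap.stateAutomaton_compositional M F, ?_,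
    fun q => (SymHeap.stateEquiv α q).1, fun q => (SymHeap.stateEquiv α q).2.1,
    fun q => (SymHeap.stateEquiv α q).2.2.1, fun q => (SymHeap.stateEquiv α q).2.2.2,
    fun τ hτ => ⟨⟨_, hex hτ⟩, fun q hq => ?_⟩⟩
  · ext τ
    constructor
    · rintro ⟨hτ, hred, q, hqF, hq⟩
      refine ⟨⟨hτ, hred⟩, ?_⟩
      have hqF' : (SymHeap.stateEquiv α q).2.2.2 = R := hqF
      rw [← hqF', ← (hnil ⟨hτ, hred⟩ q).1 hq]
      rfl
    · rintro ⟨hτ, hR⟩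
      refine ⟨hτ.1, hτ.2, _, ?_, hex hτ⟩
      show (SymHeap.stateEquiv α ((SymHeap.stateEquiv α).symm (SymHeap.stateOf M α τ))).2.2.2 = R
      rw [Equiv.apply_symm_apply]
      exact hR
  · have h := (hnil hτ q).1 hq
    simp only [← h]
    exact ⟨rfl, rfl, rfl, rfl⟩
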